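/- Let $R$ be a commutative ring with unit and let $r\ge 0$ be an integer. **Filtered complexes.** A filtered complex $(A,d,F)$ is an unbounded cochain complex of $R$-modules with an increasing filtration $\{F_pA^n\}_{p\in\mathbb Z}$ of each $A^n$ such that $d(F_pA^n)\subseteq F_pA^{n+1}$; morphisms are the morphisms of complexes compatible with filtrations. For $k\ge 0$ put $Z_k^{p,n+p}(A)=F_pA^n\cap d^{-1}(F_{p-k}A^{n+1})$, $B_0^{p,n+p}(A)=Z_0^{p-1,n+p-1}(A)$, and $B_k^{p,n+p}(A)=Z_{k-1}^{p-1,n+p-1}(A)+dZ_{k-1}^{p+k-1,n+p+k-2}(A)$ for $k\ge1$. **Spectral sequences.** A $k$-bigraded complex is a family of $R$-modules $\{A^{p,q}\}_{p,q\in\mathbb Z}$ with a differential of bidegree $(-k,1-k)$ and square zero. A spectral sequence is a family $(A_k,d_k)_{k\ge0}$ of $k$-bigraded complexes with isomorphisms of bigraded modules $H_*(A_k)\cong A_{k+1}$; a morphism is a family of morphisms of $k$-bigraded complexes, $k\ge 0$, compatible with these isomorphisms. The spectral sequence functor $E$ sends a filtered complex $A$ to the spectral sequence with pages $E_k^{p,q}(A)=Z_k^{p,q}(A)/B_k^{p,q}(A)$,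 differentials $\delta_k[a]_k=[da]_k$, and the canonical isomorphisms $H_*(E_k(A))\cong E_{k+1}(A)$. **Almost Brown categories.** An almost Brown category is a category with finite products (in particular a final object) and two classes of maps, weak equivalences and fibrations (an acyclic fibration being a map in both classes), such that: (A) weak equivalences satisfy two-out-of-three and contain all isomorphisms; (B) fibrations are closed under composition and contain all isomorphisms; (C) the pullback of an acyclic fibration along any map exists and is an acyclic fibration; (D) every map $u$ factors as $u=pi$ with $p$ a fibration and $i$ right inverse to an acyclic fibration; (E) for every object, the map to a final object is a fibration. A functor between almost Brown categories is left exact if it preserves finite products, fibrations, acyclic fibrations and pullbacks of acyclic fibrations. Let $(\mathrm{SpSe})_r$ be the category of spectral sequences, with weak equivalences the morphisms $f$ such that $f_r$ is a quasi-isomorphism, and fibrations the morphisms $f$ such that $f_k$ is bidegreewise surjective for $0\le k\le r$. Let $(\mathrm{fCpx})_r$ be the category of filtered complexes, with weak equivalences the morphisms $f$ such that $E_r(f)$ is a quasi-isomorphism, and fibrations the morphisms $f$ such that $Z_0(f)$ is surjective and $E_k(f)$ is surjective for $0\le k\le r$. **Proposition.** $(\mathrm{fCpx})_r$ and $(\mathrm{SpSe})_r$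 are almost Brown categories, and the functor $E:(\mathrm{fCpx})_r\to(\mathrm{SpSe})_r$ preserves weak equivalences and is a left exact functor of almost Brown categories. In particular it preserves pullbacks of acyclic fibrations, and these are computed pagewise: if $X=U\times_BA$ is the pullback in filtered complexes of an acyclic fibration $p:A\to B$ along a map $g:U\to B$, then for every $k\ge0$ the square of $k$-pages exhibits $E_k(X)$ as the pullback of $E_k(p)$ along $E_k(g)$ in the category of $k$-bigraded complexes. -/

import Mathlib

open CategoryTheory CategoryTheory.Limits

universe v u

noncomputable section

/-! ### Filtered complexes -/

/-- A filtered complex of `R`-modules: an unbounded cochain complex together with an increasing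
filtration `F p n` (written `F_p A^n`) of each module `A^n`, indexed by all integers `p` and
preserved by the differential. No exhaustiveness or separation is required. -/
structure FilteredComplex (R : Type u) [CommRing R] where
  /-- the underlying cochain complex -/
  cpx : CochainComplex (ModuleCat.{v} R) ℤ
  /-- the filtration: `F p n` is the submodule `F_p A^n` of `A^n` -/
  F (p n : ℤ) : Submodule R (cpx.X n)
  F_mono (p n : ℤ) : F (p - 1) n ≤ F p n
  d_mem (p n : ℤ) : ∀ x ∈ F p n, (cpx.d n (n + 1)).hom x ∈ F p (n + 1)

namespace FilteredComplex

variable {R : Type u} [CommRing R]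

/-- A morphism of filtered complexes: a morphism of complexes compatible with the filtrations. -/
@[ext]
structure Hom (A B : FilteredComplex.{v} R) where
  /-- the underlying morphism of complexes -/
  map : A.cpx ⟶ B.cpx
  map_mem (p n : ℤ) : ∀ x ∈ A.F p n, (map.f n).hom x ∈ B.F p n

instance : Category (FilteredComplex.{v} R) where
  Hom := Hom
  id A := { map := 𝟙 A.cpx, map_mem := fun _ _ _ hx => hx }
  comp f g :=
    { map := f.map ≫ g.map
      map_mem := fun p n x hx => g.map_mem p n _ (f.map_mem p n x hx) }

@[ext]
lemma hom_ext {A B : FilteredComplex.{v} R} {f g : A ⟶ B} (h : f.map = g.map) : f = g :=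
  Hom.ext h

@[simp] lemma id_map (A : FilteredComplex.{v} R) : Hom.map (𝟙 A) = 𝟙 A.cpx := rfl

@[simp] lemma comp_map {A B C : FilteredComplex.{v} R} (f : A ⟶ B) (g : B ⟶ C) :
    (f ≫ g).map = f.map ≫ g.map := rfl

/-! ### Cycles, boundaries and pages

Throughout, `n` is the degree in the complex and `p` the filtration degree, so that
`Z A r p n` is the module of `r`-cycles in bidegree `(p, n + p)`. -/

variable (A B C : FilteredComplex.{v} R)

/-- `Z_r^{p,n+p}(A) = F_p A^n ∩ d⁻¹(F_{p-r} A^{n+1})`. -/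
def Z (r p n : ℤ) : Submodule R (A.cpx.X n) :=
  A.F p n ⊓ (A.F (p - r) (n + 1)).comap (A.cpx.d n (n + 1)).hom

/-- `B_r^{p,n+p}(A) = Z_{r-1}^{p-1,n+p-1}(A) + d Z_{r-1}^{p+r-1,n+p+r-2}(A)`. For `r = 0` this is
`Z_0^{p-1,n+p-1}(A)`, see `Bdry_zero`. -/
def Bdry (r p n : ℤ) : Submodule R (A.cpx.X n) :=
  A.Z (r - 1) (p - 1) n ⊔ (A.Z (r - 1) (p + r - 1) (n - 1)).map (A.cpx.d (n - 1) n).hom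

variable {A B}

lemma mem_Z {r p n : ℤ} {x : A.cpx.X n} :
    x ∈ A.Z r p n ↔ x ∈ A.F p n ∧ (A.cpx.d n (n + 1)).hom x ∈ A.F (p - r) (n + 1) := Iff.rfl

lemma mem_Z' {r p n p' n' : ℤ} (hp : p' = p - r) (hn : n' = n + 1) {x : A.cpx.X n} :
    x ∈ A.Z r p n ↔ x ∈ A.F p n ∧ (A.cpx.d n n').hom x ∈ A.F p' n' := by
  subst hp hn; rfl

lemma d_d_apply (i j k : ℤ) (x : A.cpx.X i) : (A.cpx.d j k).hom ((A.cpx.d i j).hom x) = 0 := by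
  rw [← ModuleCat.comp_apply, A.cpx.d_comp_d]; rfl

lemma map_d_apply (f : A ⟶ B) (i j : ℤ) (x : A.cpx.X i) :
    (B.cpx.d i j).hom ((f.map.f i).hom x) = (f.map.f j).hom ((A.cpx.d i j).hom x) := by
  rw [← ModuleCat.comp_apply, ← ModuleCat.comp_apply, f.map.comm]

lemma F_mono' (p q n : ℤ) (h : q = p - 1) : A.F q n ≤ A.F p n := by
  subst h; exact A.F_mono p n

lemma d_mem' {p n n' : ℤ} (hn : n' = n + 1) {x : A.cpx.X n} (hx : x ∈ A.F p n) :
    (A.cpx.d n n').hom x ∈ A.F p n' := by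
  subst hn; exact A.d_mem p n x hx

lemma mem_Bdry {r p n n' p' : ℤ} (hn : n = n' + 1) (hp : p' = p + r - 1) {x : A.cpx.X n} :
    x ∈ A.Bdry r p n ↔
      ∃ y ∈ A.Z (r - 1) (p - 1) n, ∃ z ∈ A.Z (r - 1) p' n', y + (A.cpx.d n' n).hom z = x := by
  obtain rfl : n' = n - 1 := by omega
  subst hp
  simp only [Bdry, Submodule.mem_sup, Submodule.mem_map]
  constructor
  · rintro ⟨y, hy, _, ⟨z, hz, rfl⟩, rfl⟩
    exact ⟨y, hy, z, hz, rfl⟩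
  · rintro ⟨y, hy, z, hz, rfl⟩
    exact ⟨y, hy, _, ⟨z, hz, rfl⟩, rfl⟩

variable (A) in
/-- The `0`-cycles are `F_p A^n`. -/
lemma Z_zero (p n : ℤ) : A.Z 0 p n = A.F p n := by
  ext x
  rw [mem_Z' (p' := p) (by omega) rfl]
  exact ⟨fun h => h.1, fun h => ⟨h, d_mem' rfl h⟩⟩

variable (A) in
/-- The `0`-boundaries are `Z_0^{p-1,n+p-1}(A)`. -/
lemma Bdry_zero (p n : ℤ) : A.Bdry 0 p n = A.Z 0 (p - 1) n := by
  ext x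
  rw [mem_Bdry (n' := n - 1) (p' := p - 1) (by omega) (by omega), Z_zero]
  constructor
  · rintro ⟨y, hy, z, hz, rfl⟩
    exact add_mem hy.1 (d_mem' (by omega) hz.1)
  · intro hx
    refine ⟨x, ?_, 0, zero_mem _, by simp⟩
    rw [mem_Z' (p' := p) (by omega) rfl]
    exact ⟨hx, F_mono' p (p - 1) _ rfl (d_mem' rfl hx)⟩

lemma Bdry_le_Z (r p n : ℤ) : A.Bdry r p n ≤ A.Z r p n := by
  intro x hx
  rw [mem_Bdry (n' := n - 1) (p' := p + r - 1) (by omega) rfl] at hx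
  obtain ⟨y, hy, z, hz, rfl⟩ := hx
  rw [mem_Z' (p' := p) (by omega) (n' := n) (by omega)] at hz
  rw [mem_Z' (p' := p - r) (by omega) rfl] at hy
  refine mem_Z.2 ⟨add_mem (F_mono' p (p - 1) _ rfl hy.1) hz.2, ?_⟩
  rw [map_add, d_d_apply, add_zero]
  exact hy.2

/-- The restriction of the differential to `Z_r^{p,n+p}(A) → Z_r^{p-r,n+1+p-r}(A)`. -/
def dZ (A : FilteredComplex.{v} R) (r p n p' n' : ℤ) (hp : p' = p - r) (hn : n' = n + 1) :
    A.Z r p n →ₗ[R] A.Z r p' n' :=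
  (A.cpx.d n n').hom.restrict (fun x hx => by
    rw [mem_Z' hp hn] at hx
    rw [mem_Z' rfl rfl, d_d_apply]
    exact ⟨hx.2, zero_mem _⟩)

@[simp] lemma dZ_coe (r p n p' n' : ℤ) (hp : p' = p - r) (hn : n' = n + 1) (x : A.Z r p n) :
    (A.dZ r p n p' n' hp hn x : A.cpx.X n') = (A.cpx.d n n').hom x := rfl

/-- The map `Z_r^{p,n+p}(A) → Z_r^{p,n+p}(B)` induced by a morphism of filtered complexes. -/
def mapZ (f : A ⟶ B) (r p n : ℤ) : A.Z r p n →ₗ[R] B.Z r p n :=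
  (f.map.f n).hom.restrict (fun x hx =>
    ⟨f.map_mem _ _ _ hx.1, by
      change (B.cpx.d n (n + 1)).hom ((f.map.f n).hom x) ∈ B.F (p - r) (n + 1)
      rw [map_d_apply]
      exact f.map_mem _ _ _ hx.2⟩)

@[simp] lemma mapZ_coe (f : A ⟶ B) (r p n : ℤ) (x : A.Z r p n) :
    (mapZ f r p n x : B.cpx.X n) = (f.map.f n).hom x := rfl

/-- `E_r^{p,n+p}(A) = Z_r^{p,n+p}(A) / B_r^{p,n+p}(A)`. -/
abbrev PageX (A : FilteredComplex.{v} R) (r p n : ℤ) : Type v :=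
  A.Z r p n ⧸ (A.Bdry r p n).submoduleOf (A.Z r p n)

/-- The class `[a]_r` in `E_r` of an `r`-cycle `a`. -/
abbrev cls (A : FilteredComplex.{v} R) (r p n : ℤ) : A.Z r p n →ₗ[R] A.PageX r p n :=
  Submodule.mkQ _

lemma cls_eq_zero_iff {r p n : ℤ} (x : A.Z r p n) :
    A.cls r p n x = 0 ↔ (x : A.cpx.X n) ∈ A.Bdry r p n := by
  rw [cls, Submodule.mkQ_apply, Submodule.Quotient.mk_eq_zero]
  rfl

/-- The differential `δ_r [a]_r = [d a]_r`. -/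
def pageD (A : FilteredComplex.{v} R) (r p n p' n' : ℤ) (hp : p' = p - r) (hn : n' = n + 1) :
    A.PageX r p n →ₗ[R] A.PageX r p' n' :=
  Submodule.mapQ _ _ (A.dZ r p n p' n' hp hn) (by
    intro x hx
    have hx' : (x : A.cpx.X n) ∈ A.Bdry r p n := hx
    change (A.cpx.d n n').hom (x : A.cpx.X n) ∈ A.Bdry r p' n'
    rw [mem_Bdry (n' := n - 1) (p' := p + r - 1) (by omega) rfl] at hx'
    obtain ⟨y, hy, z, hz, e⟩ := hx'
    rw [mem_Bdry hn (p' := p - 1) (by omega), ← e, map_add, d_d_apply]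
    exact ⟨0, zero_mem _, y, hy, by simp⟩)

@[simp] lemma pageD_cls (r p n p' n' : ℤ) (hp : p' = p - r) (hn : n' = n + 1) (x : A.Z r p n) :
    A.pageD r p n p' n' hp hn (A.cls r p n x) = A.cls r p' n' (A.dZ r p n p' n' hp hn x) := rfl

/-- The map `E_r^{p,n+p}(A) → E_r^{p,n+p}(B)`, `[a]_r ↦ [f a]_r`. -/
def pageMapX (f : A ⟶ B) (r p n : ℤ) : A.PageX r p n →ₗ[R] B.PageX r p n :=
  Submodule.mapQ _ _ (mapZ f r p n) (by
    intro x hx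
    have hx' : (x : A.cpx.X n) ∈ A.Bdry r p n := hx
    change (f.map.f n).hom (x : A.cpx.X n) ∈ B.Bdry r p n
    rw [mem_Bdry (n' := n - 1) (p' := p + r - 1) (by omega) rfl] at hx' ⊢
    obtain ⟨y, hy, z, hz, e⟩ := hx'
    exact ⟨_, (mapZ f _ _ _ ⟨y, hy⟩).2, _, (mapZ f _ _ _ ⟨z, hz⟩).2, by
      simp only [mapZ_coe, map_d_apply, ← e, map_add]⟩)

@[simp] lemma pageMapX_cls (f : A ⟶ B) (r p n : ℤ) (x : A.Z r p n) :
    pageMapX f r p n (A.cls r p n x) = B.cls r p n (mapZ f r p n x) := rfl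

end FilteredComplex

/-! ### Spectral sequences -/

/-- The shape of `r`-bigraded complexes: the differential has bidegree `(-r, 1 - r)`. -/
abbrev rShape (r : ℤ) : ComplexShape (ℤ × ℤ) := ComplexShape.up' ((-r, 1 - r) : ℤ × ℤ)

/-- The category of `r`-bigraded complexes of `R`-modules. -/
abbrev BigradedComplex (R : Type u) [CommRing R] (r : ℤ) :=
  HomologicalComplex (ModuleCat.{v} R) (rShape r)

/-- The category of spectral sequences of `R`-modules, with pages indexed by `r ≥ 0`. -/
abbrev SpSe (R : Type u) [CommRing R] := SpectralSequence (ModuleCat.{v} R) rShape 0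

namespace FilteredComplex

variable {R : Type u} [CommRing R]

lemma rel_fst {r : ℤ} {i j : ℤ × ℤ} (h : (rShape r).Rel i j) : j.1 = i.1 - r := by
  have h' : i + (-r, 1 - r) = j := h
  rw [← h']; simp; omega

lemma rel_snd {r : ℤ} {i j : ℤ × ℤ} (h : (rShape r).Rel i j) :
    j.2 - j.1 = (i.2 - i.1) + 1 := by
  have h' : i + (-r, 1 - r) = j := h
  rw [← h']; simp; omega

open scoped Classical in
/-- The `r`-page of a filtered complex, an `r`-bigraded complex; in bidegree `(p, q)` it is
`E_r^{p,q}(A) = Z_r^{p,q}(A) / B_r^{p,q}(A)`, a subquotient of `A^{q-p}`. -/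
def page (A : FilteredComplex.{v} R) (r : ℤ) : BigradedComplex.{v} R r where
  X i := ModuleCat.of R (A.PageX r i.1 (i.2 - i.1))
  d i j := if h : (rShape r).Rel i j then
      ModuleCat.ofHom (A.pageD r i.1 (i.2 - i.1) j.1 (j.2 - j.1) (rel_fst h) (rel_snd h))
    else 0
  shape i j h := dif_neg h
  d_comp_d' i j k hij hjk := by
    rw [dif_pos hij, dif_pos hjk]
    ext x
    change A.cls _ _ _ (A.dZ _ _ _ _ _ _ _ (A.dZ _ _ _ _ _ _ _ x)) = 0
    rw [cls_eq_zero_iff, dZ_coe, dZ_coe, d_d_apply]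
    exact zero_mem _

lemma page_d (A : FilteredComplex.{v} R) (r : ℤ) {i j : ℤ × ℤ} (h : (rShape r).Rel i j) :
    (A.page r).d i j =
      ModuleCat.ofHom (A.pageD r i.1 (i.2 - i.1) j.1 (j.2 - j.1) (rel_fst h) (rel_snd h)) :=
  dif_pos h

/-- The morphism of `r`-bigraded complexes induced by a morphism of filtered complexes. -/
def pageMap {A B : FilteredComplex.{v} R} (f : A ⟶ B) (r : ℤ) : A.page r ⟶ B.page r where
  f i := ModuleCat.ofHom (pageMapX f r i.1 (i.2 - i.1))
  comm' i j h := by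
    rw [page_d _ _ h, page_d _ _ h]
    ext x
    obtain ⟨x, rfl⟩ := Submodule.mkQ_surjective _ x
    change B.cls _ _ _ (B.dZ _ _ _ _ _ _ _ (mapZ f _ _ _ x)) =
      B.cls _ _ _ (mapZ f _ _ _ (A.dZ _ _ _ _ _ _ _ x))
    congr 1
    exact Subtype.ext (map_d_apply f _ _ _)

/-- The inclusion `Z_{r+1} ⊆ Z_r` followed by the class map to `E_r`. -/
def cycleMap (A : FilteredComplex.{v} R) (r r' p n : ℤ) (h : r + 1 = r') :
    A.Z r' p n →ₗ[R] A.PageX r p n :=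
  A.cls r p n ∘ₗ Submodule.inclusion (by
    intro x hx
    rw [mem_Z' rfl rfl] at hx ⊢
    exact ⟨hx.1, F_mono' _ _ _ (by omega) hx.2⟩)

lemma cycleMap_eq_zero_of_mem {A : FilteredComplex.{v} R} {r r' p n : ℤ} (h : r + 1 = r')
    (x : A.Z r' p n) : A.cycleMap r r' p n h x = 0 ↔ (x : A.cpx.X n) ∈ A.Bdry r p n :=
  cls_eq_zero_iff _

lemma rel_next (r : ℤ) (i : ℤ × ℤ) : (rShape r).Rel i ((rShape r).next i) := by
  have h : (rShape r).Rel i (i + (-r, 1 - r)) := rfl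
  rw [(rShape r).next_eq' h]; exact h

lemma rel_prev (r : ℤ) (i : ℤ × ℤ) : (rShape r).Rel ((rShape r).prev i) i := by
  have h : (rShape r).Rel (i - (-r, 1 - r)) i := sub_add_cancel _ _
  rw [(rShape r).prev_eq' h]; exact h

/-- A cycle of `E_r` is exactly the class of an element of `Z_{r+1}`. -/
lemma exists_cycle {A : FilteredComplex.{v} R} {r r' p n p' n' : ℤ} (h : r + 1 = r')
    (hp : p' = p - r) (hn : n' = n + 1) (x : A.PageX r p n) (hx : A.pageD r p n p' n' hp hn x = 0) :
    ∃ z : A.Z r' p n, A.cycleMap r r' p n h z = x := by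
  obtain ⟨x, rfl⟩ := Submodule.mkQ_surjective _ x
  have hx' : A.cls r p' n' (A.dZ r p n p' n' hp hn x) = 0 := hx
  rw [cls_eq_zero_iff, dZ_coe, mem_Bdry hn (p' := p - 1) (by omega)] at hx'
  obtain ⟨w, hw, y, hy, e⟩ := hx'
  have hxZ := x.2
  rw [mem_Z' hp hn] at hxZ
  have hyF : y ∈ A.F p n := F_mono' _ _ _ rfl hy.1
  refine ⟨⟨(x : A.cpx.X n) - y, ?_⟩, ?_⟩
  · rw [mem_Z' (p' := p' - 1) (by omega) hn]
    refine ⟨sub_mem hxZ.1 hyF, ?_⟩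
    rw [map_sub, ← e, add_sub_cancel_right]
    exact hw.1
  · rw [← sub_eq_zero]
    change A.cls r p n _ - A.cls r p n _ = 0
    rw [← map_sub, cls_eq_zero_iff, mem_Bdry (n' := n - 1) (p' := p + r - 1) (by omega) rfl]
    exact ⟨-y, neg_mem hy, 0, zero_mem _, by simp [Submodule.coe_inclusion]⟩

/-- An element of `Z_{r+1}` represents a boundary of `E_r` if and only if it lies in `B_{r+1}`. -/
lemma cycleMap_eq_pageD_iff {A : FilteredComplex.{v} R} {r r' p n p' n' : ℤ} (h : r + 1 = r')
    (hp : p = p' - r) (hn : n = n' + 1) (z : A.Z r' p n) :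
    (∃ x, A.pageD r p' n' p n hp hn x = A.cycleMap r r' p n h z) ↔
      (z : A.cpx.X n) ∈ A.Bdry r' p n := by
  have hp1 : p' = p + r' - 1 := by omega
  obtain rfl : r = r' - 1 := by omega
  rw [mem_Bdry hn hp1]
  constructor
  · rintro ⟨x, hx⟩
    obtain ⟨x, rfl⟩ := Submodule.mkQ_surjective _ x
    rw [← sub_eq_zero] at hx
    change A.cls _ p n _ - A.cls _ p n _ = 0 at hx
    rw [← map_sub, cls_eq_zero_iff, mem_Bdry hn (p' := p' - 1) (by omega)] at hx
    obtain ⟨y, hy, w, hw, e⟩ := hx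
    have e' : y + (A.cpx.d n' n).hom w = (A.cpx.d n' n).hom (x : A.cpx.X n') - (z : A.cpx.X n) := e
    have hzx : (z : A.cpx.X n) = -y + (A.cpx.d n' n).hom ((x : A.cpx.X n') - w) := by
      rw [map_sub, ← eq_sub_iff_add_eq.1 e']
      abel
    refine ⟨-y, ?_, (x : A.cpx.X n') - w, sub_mem x.2 ?_, hzx.symm⟩
    · have hz := z.2
      rw [mem_Z' rfl rfl] at hz
      rw [mem_Z' (p' := p - r') (by omega) rfl]
      refine ⟨neg_mem hy.1, ?_⟩
      have hdz := hz.2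
      rw [hzx, map_add, d_d_apply, add_zero] at hdz
      exact hdz
    · rw [mem_Z' (p' := p) (by omega) hn]
      rw [mem_Z' (p' := p) (by omega) hn] at hw
      exact ⟨F_mono' _ _ _ rfl hw.1, hw.2⟩
  · rintro ⟨y, hy, x, hx, e⟩
    refine ⟨A.cls _ p' n' ⟨x, hx⟩, ?_⟩
    rw [← sub_eq_zero]
    change A.cls _ p n _ - A.cls _ p n _ = 0
    rw [← map_sub, cls_eq_zero_iff, mem_Bdry hn (p' := p + (r' - 1) - 1) rfl]
    refine ⟨-y, neg_mem ?_, 0, zero_mem _, ?_⟩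
    · rw [mem_Z' rfl rfl] at hy ⊢
      exact ⟨hy.1, F_mono' _ _ _ (by omega) hy.2⟩
    · change -y + _ = (A.cpx.d n' n).hom x - (z : A.cpx.X n)
      rw [← e]; simp

/-- `cycleMap` as a morphism to the `r`-page. -/
def cycleHom (A : FilteredComplex.{v} R) (r r' : ℤ) (i : ℤ × ℤ) (h : r + 1 = r') :
    ModuleCat.of R (A.Z r' i.1 (i.2 - i.1)) ⟶ (A.page r).X i :=
  ModuleCat.ofHom (A.cycleMap r r' i.1 (i.2 - i.1) h)

lemma cycleHom_d (A : FilteredComplex.{v} R) (r r' : ℤ) (i : ℤ × ℤ) (h : r + 1 = r') :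
    A.cycleHom r r' i h ≫ (A.page r).d i ((rShape r).next i) = 0 := by
  have hrel := rel_next r i
  rw [page_d _ _ hrel]
  ext x
  change A.cls _ _ _ (A.dZ _ _ _ _ _ (rel_fst hrel) (rel_snd hrel) (Submodule.inclusion _ x)) = 0
  have hp := rel_fst hrel
  rw [cls_eq_zero_iff, mem_Bdry (rel_snd hrel) (p' := i.1 - 1) (by omega)]
  have hx := x.2
  rw [mem_Z' (p' := ((rShape r).next i).1 - 1) (by omega) (rel_snd hrel)] at hx
  refine ⟨(A.cpx.d _ _).hom (x : A.cpx.X (i.2 - i.1)), ?_, 0, zero_mem _, ?_⟩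
  · rw [mem_Z' rfl rfl]
    refine ⟨hx.2, ?_⟩
    rw [d_d_apply]
    exact zero_mem _
  · rw [map_zero, add_zero]
    rfl

/-- The map from `Z_{r+1}^{p,q}(A)` to the cycles of `E_r(A)`. -/
def toCycles (A : FilteredComplex.{v} R) (r r' : ℤ) (i : ℤ × ℤ) (h : r + 1 = r') :
    ModuleCat.of R (A.Z r' i.1 (i.2 - i.1)) ⟶ (A.page r).cycles i :=
  (A.page r).liftCycles (A.cycleHom r r' i h) ((rShape r).next i) rfl (A.cycleHom_d r r' i h)

lemma toCycles_i (A : FilteredComplex.{v} R) (r r' : ℤ) (i : ℤ × ℤ) (h : r + 1 = r') :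
    A.toCycles r r' i h ≫ (A.page r).iCycles i = A.cycleHom r r' i h :=
  HomologicalComplex.liftCycles_i _ _ _ _ _

/-- The map `Z_{r+1}^{p,q}(A) → H(E_r(A))^{p,q}` sending `z` to the homology class of `[z]_r`. -/
def toHomology (A : FilteredComplex.{v} R) (r r' : ℤ) (i : ℤ × ℤ) (h : r + 1 = r') :
    ModuleCat.of R (A.Z r' i.1 (i.2 - i.1)) ⟶ (A.page r).homology i :=
  A.toCycles r r' i h ≫ (A.page r).homologyπ i

lemma toHomology_surjective (A : FilteredComplex.{v} R) (r r' : ℤ) (i : ℤ × ℤ) (h : r + 1 = r') :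
    Function.Surjective (A.toHomology r r' i h).hom := by
  intro y
  obtain ⟨c, rfl⟩ := (ModuleCat.epi_iff_surjective ((A.page r).homologyπ i)).1 inferInstance y
  have hc : ((A.page r).iCycles i ≫ (A.page r).d i ((rShape r).next i)).hom c = 0 := by
    rw [(A.page r).iCycles_d]; rfl
  rw [page_d _ _ (rel_next r i)] at hc
  obtain ⟨z, hz⟩ := exists_cycle h _ _ (((A.page r).iCycles i).hom c) hc
  refine ⟨z, ?_⟩
  have hzc : (A.toCycles r r' i h).hom z = c := by
    apply (ModuleCat.mono_iff_injective ((A.page r).iCycles i)).1 inferInstance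
    exact (congrArg (fun k => k.hom z) (A.toCycles_i r r' i h)).trans hz
  rw [← hzc]
  rfl

lemma toHomology_eq_zero_iff (A : FilteredComplex.{v} R) (r r' : ℤ) (i : ℤ × ℤ) (h : r + 1 = r')
    (z : A.Z r' i.1 (i.2 - i.1)) :
    (A.toHomology r r' i h).hom z = 0 ↔
      (z : A.cpx.X (i.2 - i.1)) ∈ A.Bdry r' i.1 (i.2 - i.1) := by
  have hrel := rel_prev r i
  rw [← cycleMap_eq_pageD_iff h (rel_fst hrel) (rel_snd hrel)]
  have hex : (ShortComplex.mk _ _ ((A.page r).toCycles_comp_homologyπ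
      ((rShape r).prev i) i)).Exact :=
    ShortComplex.exact_of_g_is_cokernel _ ((A.page r).homologyIsCokernel _ i rfl)
  rw [ShortComplex.moduleCat_exact_iff] at hex
  have hinj : Function.Injective ((A.page r).iCycles i).hom :=
    (ModuleCat.mono_iff_injective ((A.page r).iCycles i)).1 inferInstance
  have key : ∀ x : (A.page r).X ((rShape r).prev i),
      ((A.page r).iCycles i).hom (((A.page r).toCycles ((rShape r).prev i) i).hom x) =
      A.pageD r _ _ i.1 (i.2 - i.1) (rel_fst hrel) (rel_snd hrel) x := by
    intro x
    refine (congrArg (fun k => k.hom x) ((A.page r).toCycles_i ((rShape r).prev i) i)).trans ?_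
    rw [page_d _ _ hrel]; rfl
  have key' : ((A.page r).iCycles i).hom ((A.toCycles r r' i h).hom z) =
      A.cycleMap r r' i.1 (i.2 - i.1) h z :=
    congrArg (fun k => k.hom z) (A.toCycles_i r r' i h)
  constructor
  · intro hz
    obtain ⟨x, hx⟩ := hex ((A.toCycles r r' i h).hom z) hz
    exact ⟨x, (key x).symm.trans ((congrArg ((A.page r).iCycles i).hom hx).trans key')⟩
  · rintro ⟨x, hx⟩
    have hxz : ((A.page r).toCycles ((rShape r).prev i) i).hom x = (A.toCycles r r' i h).hom z :=
      hinj ((key x).trans (hx.trans key'.symm))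
    change ((A.page r).homologyπ i).hom ((A.toCycles r r' i h).hom z) = 0
    rw [← hxz]
    exact congrArg (fun k => k.hom x) ((A.page r).toCycles_comp_homologyπ ((rShape r).prev i) i)

/-- The isomorphism `E_{r+1}^{p,q}(A) ≅ H(E_r(A))^{p,q}`, sending `[z]_{r+1}` to the homology
class of `[z]_r`. -/
def fromPageX (A : FilteredComplex.{v} R) (r r' : ℤ) (i : ℤ × ℤ) (h : r + 1 = r') :
    A.PageX r' i.1 (i.2 - i.1) ≃ₗ[R] (A.page r).homology i :=
  LinearEquiv.ofBijective
    (Submodule.liftQ _ (A.toHomology r r' i h).hom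
      (fun z hz => (A.toHomology_eq_zero_iff r r' i h z).2 hz)) (by
    constructor
    · rw [injective_iff_map_eq_zero]
      intro x hx
      obtain ⟨z, rfl⟩ := Submodule.mkQ_surjective _ x
      exact (cls_eq_zero_iff z).2 ((A.toHomology_eq_zero_iff r r' i h z).1 hx)
    · intro y
      obtain ⟨z, rfl⟩ := A.toHomology_surjective r r' i h y
      exact ⟨A.cls _ _ _ z, rfl⟩)

/-- The characteristic isomorphism `H(E_r(A))^{p,q} ≅ E_{r+1}^{p,q}(A)`. -/
def charIso (A : FilteredComplex.{v} R) (r r' : ℤ) (i : ℤ × ℤ) (h : r + 1 = r') :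
    (A.page r).homology i ≅ (A.page r').X i :=
  (A.fromPageX r r' i h).symm.toModuleIso

/-- The characteristic isomorphism sends the homology class of `[z]_r` to `[z]_{r+1}`. -/
lemma charIso_toHomology (A : FilteredComplex.{v} R) (r r' : ℤ) (i : ℤ × ℤ) (h : r + 1 = r')
    (z : A.Z r' i.1 (i.2 - i.1)) :
    (A.charIso r r' i h).hom.hom ((A.toHomology r r' i h).hom z) =
      A.cls r' i.1 (i.2 - i.1) z :=
  (A.fromPageX r r' i h).symm_apply_apply (A.cls r' i.1 (i.2 - i.1) z)

lemma toHomology_naturality {A B : FilteredComplex.{v} R} (f : A ⟶ B) (r r' : ℤ) (i : ℤ × ℤ)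
    (h : r + 1 = r') :
    A.toHomology r r' i h ≫ HomologicalComplex.homologyMap (pageMap f r) i =
      ModuleCat.ofHom (mapZ f r' i.1 (i.2 - i.1)) ≫ B.toHomology r r' i h := by
  rw [toHomology, toHomology, Category.assoc, HomologicalComplex.homologyπ_naturality,
    ← Category.assoc, ← Category.assoc]
  congr 1
  rw [← cancel_mono ((B.page r).iCycles i), Category.assoc, Category.assoc,
    HomologicalComplex.cyclesMap_i, toCycles_i, ← Category.assoc, toCycles_i]
  rfl

variable (R) in
/-- The functor `E` sending a filtered complex to its spectral sequence. -/
def spectralSequence : FilteredComplex.{v} R ⥤ SpSe.{v} R where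
  obj A :=
    { page := fun r _ => A.page r
      iso := fun r r' i hrr' _ => A.charIso r r' i hrr' }
  map {A B} f :=
    { hom := fun r _ => pageMap f r
      comm := fun r r' i hrr' _ => by
        ext y
        obtain ⟨z, rfl⟩ := A.toHomology_surjective r r' i hrr' y
        rw [ModuleCat.hom_comp, ModuleCat.hom_comp, LinearMap.comp_apply, LinearMap.comp_apply,
          charIso_toHomology]
        have := congrArg (fun k => k.hom z) (toHomology_naturality f r r' i hrr')
        simp only [ModuleCat.hom_comp, LinearMap.comp_apply] at this
        rw [this]
        exact charIso_toHomology B r r' i hrr' _ }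
  map_id A := by
    ext r hr i x
    obtain ⟨z, rfl⟩ := Submodule.mkQ_surjective _ x
    rfl
  map_comp f g := by
    ext r hr i x
    obtain ⟨z, rfl⟩ := Submodule.mkQ_surjective _ x
    rfl

end FilteredComplex

/-! ### Almost Brown categories -/

section AlmostBrown

variable {C : Type*} [Category C] {D : Type*} [Category D]

/-- The category `C` with the class `W` of weak equivalences and the class `Fib` of fibrations is
an almost Brown category. The acyclic fibrations are the elements of `W ⊓ Fib`. -/
structure IsAlmostBrown (W Fib : MorphismProperty C) : Prop where
  hasFiniteProducts : HasFiniteProducts C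
  /-- weak equivalences have the two-out-of-three property -/
  twoOutOfThree : W.HasTwoOutOfThreeProperty
  weq_of_isIso : ∀ {X Y : C} (f : X ⟶ Y), IsIso f → W f
  fib_comp : ∀ {X Y T : C} (f : X ⟶ Y) (g : Y ⟶ T), Fib f → Fib g → Fib (f ≫ g)
  fib_of_isIso : ∀ {X Y : C} (f : X ⟶ Y), IsIso f → Fib f
  /-- pullbacks of acyclic fibrations along any map exist -/
  hasPullback : ∀ {X Y S : C} (p : X ⟶ S) (g : Y ⟶ S), (W ⊓ Fib) p → HasPullback p g
  /-- pullbacks of acyclic fibrations are acyclic fibrations -/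
  acyclicFib_of_isPullback : ∀ {P X Y S : C} {p' : P ⟶ Y} {g' : P ⟶ X} {p : X ⟶ S} {g : Y ⟶ S},
    IsPullback g' p' p g → (W ⊓ Fib) p → (W ⊓ Fib) p'
  /-- any `u` factors as a right inverse of an acyclic fibration followed by a fibration -/
  factorization : ∀ {X Y : C} (u : X ⟶ Y), ∃ (T : C) (i : X ⟶ T) (p : T ⟶ Y) (q : T ⟶ X),
    i ≫ p = u ∧ Fib p ∧ i ≫ q = 𝟙 X ∧ (W ⊓ Fib) q
  /-- every object is fibrant -/
  fibrant : ∀ {X e : C}, IsTerminal e → ∀ f : X ⟶ e, Fib f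

/-- A functor between almost Brown categories is left exact if it preserves finite products,
fibrations, acyclic fibrations and pullbacks of acyclic fibrations. -/
structure IsLeftExactFunctor (W Fib : MorphismProperty C) (W' Fib' : MorphismProperty D)
    (G : C ⥤ D) : Prop where
  finiteProducts : PreservesFiniteProducts G
  fib : ∀ {X Y : C} (f : X ⟶ Y), Fib f → Fib' (G.map f)
  acyclicFib : ∀ {X Y : C} (f : X ⟶ Y), (W ⊓ Fib) f → (W' ⊓ Fib') (G.map f)
  pullback : ∀ {P X Y S : C} {p' : P ⟶ Y} {g' : P ⟶ X} {p : X ⟶ S} {g : Y ⟶ S},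
    IsPullback g' p' p g → (W ⊓ Fib) p →
      IsPullback (G.map g') (G.map p') (G.map p) (G.map g)

end AlmostBrown

/-! ### The two classes of maps on spectral sequences and on filtered complexes -/

section Classes

variable (R : Type u) [CommRing R] (r : ℕ)

/-- `E_r`-quasi-isomorphisms of spectral sequences: the map of `r`-pages is a
quasi-isomorphism. -/
def SpSe.weq : MorphismProperty (SpSe.{v} R) :=
  fun _ _ f => QuasiIso (SpectralSequence.Hom.hom f (r : ℤ))

/-- `r`-fibrations of spectral sequences: the maps of `k`-pages are bidegreewise surjective for
`0 ≤ k ≤ r`. -/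
def SpSe.fib : MorphismProperty (SpSe.{v} R) :=
  fun _ _ f => ∀ k : ℕ, k ≤ r → ∀ i : ℤ × ℤ,
    Function.Surjective ((SpectralSequence.Hom.hom f (k : ℤ)).f i)

/-- `E_r`-quasi-isomorphisms of filtered complexes. -/
def FilteredComplex.weq : MorphismProperty (FilteredComplex.{v} R) :=
  fun _ _ f => QuasiIso (FilteredComplex.pageMap f (r : ℤ))

/-- Fibrations of filtered complexes: the maps `f` such that `Z_0(f)` is surjective and `E_k(f)`
is surjective for `0 ≤ k ≤ r`. -/
def FilteredComplex.fib : MorphismProperty (FilteredComplex.{v} R) :=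
  fun _ _ f => (∀ p n : ℤ, Function.Surjective (FilteredComplex.mapZ f 0 p n)) ∧
    ∀ k : ℕ, k ≤ r → ∀ i : ℤ × ℤ,
      Function.Surjective ((FilteredComplex.pageMap f (k : ℤ)).f i)

end Classes

end

/-! Weak equivalences are seen on one page: a morphism is a quasi-isomorphism on page `r` exactly
when it is an isomorphism on page `r + 1`, and then it is one on all later pages. An acyclic
fibration is therefore surjective on every page, up to `r` by definition and beyond `r` because it
is bijective there.

Pullbacks rest on `HomologicalComplex.isPullback_homologyMap`: homology preserves the pullback of a
map that is surjective both degreewise and in homology. For an acyclic fibration of spectral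
sequences both surjectivities hold on every page, so the pages of the fibre product again form a
spectral sequence (`pagewisePullback`). For filtered complexes the 0-page of a fibre product is the
fibre product of the 0-pages (`isPullback_page_zero`, by surjectivity on each filtration step), and
induction on the page gives all the others (`isPullback_page_of_first`). Hence `E` preserves these
pullbacks, and stability of acyclic fibrations is checked page by page.

Factorizations come from additivity. Suppose that for each `k ≤ r` there is an object `D k` whose
`(r + 1)`-page vanishes, with a map to `Y` surjective on page `k`. Then `u : X ⟶ Y` factors through
`X ⊞ ⨁ D`: the map to `Y` is a fibration, and the projection to `X` is a split epimorphism and a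
weak equivalence. For spectral sequences `D k` is `SpSe.disc`, built from all systems of
representatives on pages `0, …, k`; for filtered complexes it is `FilteredComplex.path`, built from
the `k`-cycles of `Y`, and the case `k = 0` also gives surjectivity of `Z_0`. -/

noncomputable section

/-! ### Pullbacks of modules and of complexes, and their homology -/

namespace ModuleCat

variable {R : Type u} [CommRing R]

/-- A commutative square of modules is a pullback if and only if the comparison map to the
elementwise fibre product is bijective. -/
lemma isPullback_iff_elementwise {P X Y S : ModuleCat.{v} R} {a : P ⟶ X} {b : P ⟶ Y} {f : X ⟶ S}
    {g : Y ⟶ S} :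
    IsPullback a b f g ↔ a ≫ f = b ≫ g ∧
      (∀ z : P, a.hom z = 0 → b.hom z = 0 → z = 0) ∧
      ∀ (x : X) (y : Y), f.hom x = g.hom y → ∃ z : P, a.hom z = x ∧ b.hom z = y := by
  constructor
  · intro h
    have h' := (Types.isPullback_iff _ _ _ _).1 (h.map (forget (ModuleCat.{v} R)))
    refine ⟨h.w, fun z h1 h2 => ?_, fun x y hxy => h'.2.2 x y hxy⟩
    refine h'.2.1 z 0 ⟨h1.trans (map_zero a.hom).symm, h2.trans (map_zero b.hom).symm⟩
  · rintro ⟨w, h1, h2⟩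
    refine IsPullback.of_map_of_faithful (forget (ModuleCat.{v} R)) ?_
    refine (Types.isPullback_iff _ _ _ _).2
      ⟨?_, fun x y hxy => ?_, fun x y hxy => h2 x y hxy⟩
    · rw [← Functor.map_comp, w, Functor.map_comp]
    · rw [← sub_eq_zero]
      refine h1 _ ?_ ?_
      · rw [map_sub, sub_eq_zero]; exact hxy.1
      · rw [map_sub, sub_eq_zero]; exact hxy.2

end ModuleCat

namespace HomologicalComplex

section Pullback

variable {C : Type*} [Category C] [HasZeroMorphisms C] {ι : Type*} {c : ComplexShape ι}

/-- The map into a degreewise pullback of complexes given by maps into the two factors. -/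
def liftOfEval {P X Y S : HomologicalComplex C c} {a : P ⟶ X} {b : P ⟶ Y} {f : X ⟶ S}
    {g : Y ⟶ S} (h : ∀ i, IsPullback (a.f i) (b.f i) (f.f i) (g.f i)) {T : HomologicalComplex C c}
    (x : T ⟶ X) (y : T ⟶ Y) (w : x ≫ f = y ≫ g) : T ⟶ P where
  f i := (h i).lift (x.f i) (y.f i) (by rw [← comp_f, w, comp_f])
  comm' i j _ := by
    apply (h j).hom_ext
    · rw [Category.assoc, Category.assoc, IsPullback.lift_fst, ← Hom.comm,
        IsPullback.lift_fst_assoc, Hom.comm]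
    · rw [Category.assoc, Category.assoc, IsPullback.lift_snd, ← Hom.comm,
        IsPullback.lift_snd_assoc, Hom.comm]

/-- A square of complexes that is a pullback in each degree is a pullback. -/
lemma isPullback_of_eval {P X Y S : HomologicalComplex C c} {a : P ⟶ X} {b : P ⟶ Y} {f : X ⟶ S}
    {g : Y ⟶ S} (h : ∀ i, IsPullback (a.f i) (b.f i) (f.f i) (g.f i)) : IsPullback a b f g := by
  have w : a ≫ f = b ≫ g := by
    ext i
    exact (h i).w
  refine ⟨⟨w⟩, ⟨PullbackCone.IsLimit.mk w (fun s => liftOfEval h s.fst s.snd s.condition)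
    (fun s => ?_) (fun s => ?_) (fun s m h1 h2 => ?_)⟩⟩
  · ext i; exact (h i).lift_fst _ _ _
  · ext i; exact (h i).lift_snd _ _ _
  · ext i
    apply (h i).hom_ext
    · exact (congrArg (fun k => k.f i) h1).trans ((h i).lift_fst _ _ _).symm
    · exact (congrArg (fun k => k.f i) h2).trans ((h i).lift_snd _ _ _).symm

lemma isPullback_eval [HasPullbacks C] {P X Y S : HomologicalComplex C c} {a : P ⟶ X} {b : P ⟶ Y}
    {f : X ⟶ S} {g : Y ⟶ S} (h : IsPullback a b f g) (i : ι) :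
    IsPullback (a.f i) (b.f i) (f.f i) (g.f i) :=
  h.map (eval C c i)

end Pullback

variable {R : Type u} [CommRing R] {ι : Type*} {c : ComplexShape ι}
  {K L : HomologicalComplex (ModuleCat.{v} R) c}

/-- `x` is a cycle of `K` in degree `i` representing the homology class `h`. -/
def IsRep (K : HomologicalComplex (ModuleCat.{v} R) c) (i : ι) (x : K.X i) (h : K.homology i) :
    Prop :=
  ∃ z : K.cycles i, (K.iCycles i).hom z = x ∧ (K.homologyπ i).hom z = h

lemma exists_isRep (K : HomologicalComplex (ModuleCat.{v} R) c) (i : ι) (h : K.homology i) :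
    ∃ x, K.IsRep i x h := by
  obtain ⟨z, rfl⟩ := (ModuleCat.epi_iff_surjective (K.homologyπ i)).1 inferInstance h
  exact ⟨_, z, rfl, rfl⟩

lemma iCycles_injective (K : HomologicalComplex (ModuleCat.{v} R) c) (i : ι) :
    Function.Injective (K.iCycles i).hom :=
  (ModuleCat.mono_iff_injective (K.iCycles i)).1 inferInstance

variable {i : ι} {x x' : K.X i} {h h' : K.homology i}

lemma IsRep.d_eq_zero (H : K.IsRep i x h) (j : ι) : (K.d i j).hom x = 0 := by
  obtain ⟨z, rfl, -⟩ := H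
  exact congrArg (fun k => k.hom z) (K.iCycles_d i j)

lemma exists_cycles_eq (K : HomologicalComplex (ModuleCat.{v} R) c) {i : ι} {x : K.X i}
    (hx : (K.d i (c.next i)).hom x = 0) : ∃ z : K.cycles i, (K.iCycles i).hom z = x := by
  have hex : (ShortComplex.mk _ _ (K.iCycles_d i (c.next i))).Exact :=
    ShortComplex.exact_of_f_is_kernel _ (K.cyclesIsKernel i _ rfl)
  rw [ShortComplex.moduleCat_exact_iff] at hex
  exact hex x hx

lemma exists_homology_isRep (hx : (K.d i (c.next i)).hom x = 0) : ∃ h, K.IsRep i x h := by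
  obtain ⟨z, hz⟩ := K.exists_cycles_eq hx
  exact ⟨_, z, hz, rfl⟩

lemma IsRep.eq (H : K.IsRep i x h) (H' : K.IsRep i x h') : h = h' := by
  obtain ⟨z, rfl, rfl⟩ := H
  obtain ⟨z', e, rfl⟩ := H'
  rw [K.iCycles_injective i e]

lemma IsRep.add (H : K.IsRep i x h) (H' : K.IsRep i x' h') : K.IsRep i (x + x') (h + h') := by
  obtain ⟨z, rfl, rfl⟩ := H
  obtain ⟨z', rfl, rfl⟩ := H'
  exact ⟨z + z', map_add _ _ _, map_add _ _ _⟩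

lemma IsRep.smul (H : K.IsRep i x h) (t : R) : K.IsRep i (t • x) (t • h) := by
  obtain ⟨z, rfl, rfl⟩ := H
  exact ⟨t • z, map_smul _ _ _, map_smul _ _ _⟩

lemma IsRep.sub (H : K.IsRep i x h) (H' : K.IsRep i x' h') : K.IsRep i (x - x') (h - h') := by
  obtain ⟨z, rfl, rfl⟩ := H
  obtain ⟨z', rfl, rfl⟩ := H'
  exact ⟨z - z', map_sub _ _ _, map_sub _ _ _⟩

lemma isRep_zero : K.IsRep i 0 0 := ⟨0, map_zero _, map_zero _⟩

lemma IsRep.map (f : K ⟶ L) (H : K.IsRep i x h) :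
    L.IsRep i ((f.f i).hom x) ((homologyMap f i).hom h) := by
  obtain ⟨z, rfl, rfl⟩ := H
  exact ⟨(cyclesMap f i).hom z, congrArg (fun k => k.hom z) (cyclesMap_i f i),
    congrArg (fun k => k.hom z) (homologyπ_naturality f i).symm⟩

lemma isRep_zero_iff : K.IsRep i x 0 ↔ ∃ w, (K.d (c.prev i) i).hom w = x := by
  have hex : (ShortComplex.mk _ _ (K.toCycles_comp_homologyπ (c.prev i) i)).Exact :=
    ShortComplex.exact_of_g_is_cokernel _ (K.homologyIsCokernel _ i rfl)
  rw [ShortComplex.moduleCat_exact_iff] at hex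
  constructor
  · rintro ⟨z, rfl, hz⟩
    obtain ⟨w, hw⟩ := hex z hz
    exact ⟨w, (congrArg (fun k => k.hom w) (K.toCycles_i (c.prev i) i)).symm.trans
      (congrArg (K.iCycles i).hom hw)⟩
  · rintro ⟨w, rfl⟩
    exact ⟨(K.toCycles (c.prev i) i).hom w, congrArg (fun k => k.hom w) (K.toCycles_i _ i),
      congrArg (fun k => k.hom w) (K.toCycles_comp_homologyπ (c.prev i) i)⟩

lemma isRep_of_d {j : ι} (hr : c.Rel j i) (w : K.X j) (hx : x = (K.d j i).hom w) :
    K.IsRep i x 0 := by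
  obtain rfl := c.prev_eq' hr
  exact isRep_zero_iff.2 ⟨w, hx.symm⟩

lemma IsRep.exists_d_eq_sub (H : K.IsRep i x h) (H' : K.IsRep i x' h) :
    ∃ w, (K.d (c.prev i) i).hom w = x - x' := by
  have := H.sub H'
  rw [sub_self] at this
  exact isRep_zero_iff.1 this

lemma IsRep.of_eq_sub_d (H : K.IsRep i x h) (w) : K.IsRep i (x - (K.d (c.prev i) i).hom w) h := by
  simpa using H.sub (isRep_zero_iff.2 ⟨w, rfl⟩)

lemma hom_d_apply (f : K ⟶ L) (i j : ι) (x : K.X i) :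
    (L.d i j).hom ((f.f i).hom x) = (f.f j).hom ((K.d i j).hom x) :=
  congrArg (fun k => k.hom x) (f.comm i j)

lemma d_d_elem (K : HomologicalComplex (ModuleCat.{v} R) c) (i j k : ι) (x : K.X i) :
    (K.d j k).hom ((K.d i j).hom x) = 0 :=
  congrArg (fun k => k.hom x) (K.d_comp_d i j k)

/-- Homology preserves the pullback of a degreewise surjective morphism that is also surjective in
homology. -/
lemma isPullback_homologyMap {P X Y S : HomologicalComplex (ModuleCat.{v} R) c} {a : P ⟶ X}
    {b : P ⟶ Y} {f : X ⟶ S} {g : Y ⟶ S} (H : IsPullback a b f g)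
    (hf : ∀ i, Function.Surjective (f.f i))
    (hf' : ∀ i, Function.Surjective (homologyMap f i)) (i : ι) :
    IsPullback (homologyMap a i) (homologyMap b i) (homologyMap f i) (homologyMap g i) := by
  have HE := fun i => ModuleCat.isPullback_iff_elementwise.1 (isPullback_eval H i)
  have hd : ∀ (i j : ι) (z : P.X i), (X.d i j).hom ((a.f i).hom z) = 0 →
      (Y.d i j).hom ((b.f i).hom z) = 0 → (P.d i j).hom z = 0 := fun i j z h1 h2 => by
    rw [hom_d_apply] at h1 h2
    exact (HE j).2.1 _ h1 h2
  refine ModuleCat.isPullback_iff_elementwise.2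
    ⟨by rw [← homologyMap_comp, H.w, homologyMap_comp], fun z h1 h2 => ?_, fun x y hxy => ?_⟩
  · have hw : ∀ j (t : P.X j), (f.f j).hom ((a.f j).hom t) = (g.f j).hom ((b.f j).hom t) :=
      fun j t => congrArg (fun k => (k.f j).hom t) H.w
    obtain ⟨z, hz⟩ := P.exists_isRep i z
    have r1 := hz.map a
    have r2 := hz.map b
    rw [h1] at r1
    rw [h2] at r2
    obtain ⟨x, hx⟩ := isRep_zero_iff.1 r1
    obtain ⟨y, hy⟩ := isRep_zero_iff.1 r2
    -- When `i` has no predecessor, `c.prev i` is a default value and the differential from it is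
    -- zero, so both projections of the cycle vanish.
    by_cases hr : c.Rel (c.prev i) i
    · generalize c.prev i = j at *
      -- The primitives `x` and `y` need not agree in `S`; their discrepancy is a cycle.
      -- Surjectivity of `f` in homology lifts its class to a cycle `x'`, and degreewise
      -- surjectivity lifts the remaining boundary. The corrected primitive `x + x' + d v` has the
      -- same differential as `x` and matches `y`.
      have hcyc : (S.d j (c.next j)).hom ((g.f j).hom y - (f.f j).hom x) = 0 := by
        rw [c.next_eq' hr, map_sub, hom_d_apply, hom_d_apply, hx, hy, hw, sub_self]
      obtain ⟨s, hs⟩ := exists_homology_isRep hcyc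
      obtain ⟨t, rfl⟩ := hf' j s
      obtain ⟨x', hx'⟩ := X.exists_isRep j t
      obtain ⟨v, hv⟩ := hs.exists_d_eq_sub (hx'.map f)
      obtain ⟨v, rfl⟩ := hf _ v
      obtain ⟨q, hq1, hq2⟩ := (HE j).2.2 (x + x' + (X.d _ j).hom v) y (by
        change (S.d _ _).hom ((f.f _).hom v) = _ at hv
        rw [hom_d_apply] at hv
        rw [map_add, map_add, hv]
        abel)
      refine hz.eq (isRep_of_d hr q ?_)
      refine sub_eq_zero.1 ((HE i).2.1 _ ?_ ?_)
      · rw [map_sub, ← hom_d_apply, hq1, map_add, map_add, hx'.d_eq_zero, d_d_elem, hx]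
        simp
      · rw [map_sub, ← hom_d_apply, hq2, hy, sub_self]
    · refine hz.eq ?_
      rw [(HE i).2.1 z (by rw [← hx, X.shape _ _ hr]; rfl) (by rw [← hy, Y.shape _ _ hr]; rfl)]
      exact isRep_zero
  -- Representatives of the two classes agree in `S` only up to a boundary. Lifting a primitive of
  -- it along `f` changes `x'` within its class until the two agree exactly.
  · obtain ⟨x', hx⟩ := X.exists_isRep i x
    obtain ⟨y', hy⟩ := Y.exists_isRep i y
    have r1 := hx.map f
    rw [hxy] at r1
    obtain ⟨v, hv⟩ := r1.exists_d_eq_sub (hy.map g)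
    obtain ⟨v, rfl⟩ := hf _ v
    change (S.d _ _).hom ((f.f _).hom v) = _ at hv
    rw [hom_d_apply] at hv
    obtain ⟨q, hq1, hq2⟩ := (HE i).2.2 (x' - (X.d _ i).hom v) y' (by
      rw [map_sub, hv, sub_sub_cancel])
    obtain ⟨h, hh⟩ := exists_homology_isRep (hd i (c.next i) q (by
      rw [hq1, map_sub, d_d_elem, hx.d_eq_zero, sub_zero]) (by rw [hq2, hy.d_eq_zero]))
    have r2 := hh.map a
    have r3 := hh.map b
    rw [hq1] at r2
    rw [hq2] at r3
    exact ⟨h, r2.eq (hx.of_eq_sub_d v), r3.eq hy⟩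

end HomologicalComplex

/-! ### Spectral sequences: additive structure and pagewise pullbacks -/

namespace CategoryTheory.SpectralSequence

section Abelian

variable {C : Type*} [Category C] [Abelian C] {κ : Type*} {c : ℤ → ComplexShape κ} {r₀ : ℤ}
  {E E' : SpectralSequence C c r₀}

instance : Zero (E ⟶ E') where
  zero := { hom := fun _ _ => 0
            comm := fun r r' pq hrr' hr => by
              rw [HomologicalComplex.homologyMap_zero, zero_comp]; exact comp_zero.symm }

instance : Add (E ⟶ E') where
  add f g := { hom := fun r hr => Hom.hom f r + Hom.hom g r
               comm := fun r r' pq hrr' hr => by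
                rw [HomologicalComplex.homologyMap_add, Preadditive.add_comp,
                  HomologicalComplex.add_f_apply, Preadditive.comp_add, f.comm r r', g.comm r r'] }

instance : Neg (E ⟶ E') where
  neg f := { hom := fun r hr => - Hom.hom f r
             comm := fun r r' pq hrr' hr => by
                rw [HomologicalComplex.homologyMap_neg, Preadditive.neg_comp,
                  HomologicalComplex.neg_f_apply, Preadditive.comp_neg, f.comm r r'] }

instance : AddCommGroup (E ⟶ E') where
  add_assoc f g h := hom_ext fun _ _ => add_assoc _ _ _
  zero_add f := hom_ext fun _ _ => zero_add _
  add_zero f := hom_ext fun _ _ => add_zero _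
  add_comm f g := hom_ext fun _ _ => add_comm _ _
  neg_add_cancel f := hom_ext fun _ _ => neg_add_cancel _
  nsmul := nsmulRec
  zsmul := zsmulRec

instance : Preadditive (SpectralSequence C c r₀) where
  add_comp _ _ _ _ _ _ := hom_ext fun _ _ => Preadditive.add_comp _ _ _ _ _ _
  comp_add _ _ _ _ _ _ := hom_ext fun _ _ => Preadditive.comp_add _ _ _ _ _ _

instance (r : ℤ) (hr : r₀ ≤ r) : (pageFunctor C c r₀ r hr).Additive where

variable (C c r₀) in
/-- The spectral sequence all of whose pages vanish. -/
def zero : SpectralSequence C c r₀ where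
  page r _ := (HasZeroObject.zero (C := HomologicalComplex C (c r))).choose
  iso r r' pq _ _ := IsZero.iso
    ((HomologicalComplex.homologyFunctor C (c r) pq).map_isZero
      (HasZeroObject.zero (C := HomologicalComplex C _)).choose_spec)
    ((HomologicalComplex.eval C (c r') pq).map_isZero
      (HasZeroObject.zero (C := HomologicalComplex C _)).choose_spec)

variable (C c r₀) in
lemma isZero_zero : IsZero (zero C c r₀) := by
  rw [IsZero.iff_id_eq_zero]
  refine hom_ext fun r hr => ?_
  exact (HasZeroObject.zero (C := HomologicalComplex C (c r))).choose_spec.eq_of_src _ _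

instance : HasZeroObject (SpectralSequence C c r₀) := ⟨_, isZero_zero C c r₀⟩

/-- A square of spectral sequences that is a pullback on each page is a pullback. -/
lemma isPullback_of_page {P X Y S : SpectralSequence C c r₀} {a : P ⟶ X} {b : P ⟶ Y} {f : X ⟶ S}
    {g : Y ⟶ S}
    (h : ∀ r (hr : r₀ ≤ r), IsPullback (Hom.hom a r) (Hom.hom b r) (Hom.hom f r) (Hom.hom g r)) :
    IsPullback a b f g := by
  have w : a ≫ f = b ≫ g := by
    refine hom_ext fun r hr => ?_
    exact (h r hr).w
  refine ⟨⟨w⟩, ⟨PullbackCone.IsLimit.mk w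
    (fun s => { hom := fun r hr => (h r hr).lift (Hom.hom s.fst r) (Hom.hom s.snd r)
                  (by rw [← comp_hom _ _ r hr, s.condition, comp_hom])
                comm := fun r r' pq hrr' hr => ?_ })
    (fun s => ?_) (fun s => ?_) (fun s m h1 h2 => ?_)⟩⟩
  · have ha := a.comm r r' pq
    have hb := b.comm r r' pq
    apply (HomologicalComplex.isPullback_eval (h r' (by lia)) pq).hom_ext
    · rw [Category.assoc, Category.assoc, ← ha, ← HomologicalComplex.comp_f, IsPullback.lift_fst,
        ← Category.assoc, ← HomologicalComplex.homologyMap_comp, IsPullback.lift_fst]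
      exact s.fst.comm r r' pq
    · rw [Category.assoc, Category.assoc, ← hb, ← HomologicalComplex.comp_f, IsPullback.lift_snd,
        ← Category.assoc, ← HomologicalComplex.homologyMap_comp, IsPullback.lift_snd]
      exact s.snd.comm r r' pq
  · refine hom_ext fun r hr => ?_; exact (h r hr).lift_fst _ _ _
  · refine hom_ext fun r hr => ?_; exact (h r hr).lift_snd _ _ _
  · refine hom_ext fun r hr => ?_
    apply (h r hr).hom_ext
    · exact (congrArg (fun k => Hom.hom k r) h1).trans ((h r hr).lift_fst _ _ _).symm
    · exact (congrArg (fun k => Hom.hom k r) h2).trans ((h r hr).lift_snd _ _ _).symm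

end Abelian

variable {R : Type u} [CommRing R] {κ : Type*} {c : ℤ → ComplexShape κ} {r₀ : ℤ}

/-- Surjectivity of a morphism of spectral sequences on each page. -/
def PagesSurjective {X S : SpectralSequence (ModuleCat.{v} R) c r₀} (f : X ⟶ S) : Prop :=
  ∀ (r : ℤ) (hr : r₀ ≤ r) (i : κ), Function.Surjective ((Hom.hom f r).f i)

variable {P X Y S : SpectralSequence (ModuleCat.{v} R) c r₀} {a : P ⟶ X} {b : P ⟶ Y}
    {f : X ⟶ S} {g : Y ⟶ S}

lemma surjective_homologyMap_iff (f : X ⟶ S) (r r' : ℤ) (hr : r₀ ≤ r) (hrr' : r + 1 = r')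
    (i : κ) :
    Function.Surjective (HomologicalComplex.homologyMap (Hom.hom f r) i) ↔
      Function.Surjective ((Hom.hom f r').f i) := by
  have h := Hom.comm f r r' i hrr' hr
  rw [← ModuleCat.epi_iff_surjective, ← ModuleCat.epi_iff_surjective]
  constructor
  · intro _
    have : Epi ((X.iso r r' i).hom ≫ (Hom.hom f r').f i) := h ▸ inferInstance
    exact epi_of_epi (X.iso r r' i hrr' hr).hom _
  · intro _
    have : Epi (HomologicalComplex.homologyMap (Hom.hom f r) i ≫ (S.iso r r' i).hom) :=
      h ▸ inferInstance
    rw [← Category.comp_id (HomologicalComplex.homologyMap (Hom.hom f r) i),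
      ← (S.iso r r' i).hom_inv_id, ← Category.assoc]
    infer_instance

/-- The characteristic isomorphisms identify the map in homology with the map on the next page.
Being a weak equivalence thus becomes an isomorphism condition, which pullbacks preserve and
additive functors can test. -/
lemma quasiIso_hom_iff (f : X ⟶ S) (r r' : ℤ) (hr : r₀ ≤ r) (hrr' : r + 1 = r') :
    QuasiIso (Hom.hom f r) ↔ ∀ i, IsIso ((Hom.hom f r').f i) := by
  rw [quasiIso_iff]
  refine forall_congr' fun i => ?_
  have h := Hom.comm f r r' i hrr' hr
  rw [quasiIsoAt_iff_isIso_homologyMap]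
  constructor
  · intro _
    have : IsIso ((X.iso r r' i hrr' hr).hom ≫ (Hom.hom f r').f i) := h ▸ inferInstance
    exact IsIso.of_isIso_comp_left (X.iso r r' i hrr' hr).hom _
  · intro _
    have : IsIso (HomologicalComplex.homologyMap (Hom.hom f r) i ≫ (S.iso r r' i hrr' hr).hom) :=
      h ▸ inferInstance
    exact IsIso.of_isIso_comp_right _ (S.iso r r' i hrr' hr).hom

/-- An isomorphism of pages is a quasi-isomorphism, so the isomorphism propagates from each page to
the next. -/
lemma isIso_page_of_quasiIso (f : X ⟶ S) (r : ℤ) (hr : r₀ ≤ r) (hf : QuasiIso (Hom.hom f r))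
    (r' : ℤ) (hr' : r + 1 ≤ r') (i : κ) : IsIso ((Hom.hom f r').f i) := by
  induction r', hr' using Int.leInduction generalizing i with
  | base => exact (quasiIso_hom_iff f r _ hr rfl).1 hf i
  | succ r' hr' ih =>
    refine (quasiIso_hom_iff f r' _ (by lia) rfl).1 ?_ i
    have : IsIso (Hom.hom f r') := HomologicalComplex.Hom.isIso_of_components _
    infer_instance

/-- A morphism that is surjective up to page `r` and a quasi-isomorphism on page `r` is surjective
on each page. -/
lemma pagesSurjective_of_quasiIso (f : X ⟶ S) (r : ℤ) (hr : r₀ ≤ r)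
    (hf : QuasiIso (Hom.hom f r))
    (hf' : ∀ (k : ℤ) (hk : r₀ ≤ k), k ≤ r → ∀ i, Function.Surjective ((Hom.hom f k).f i)) :
    PagesSurjective f := fun k hk i => by
  by_cases h : k ≤ r
  · exact hf' k hk h i
  · have := isIso_page_of_quasiIso f r hr hf k (by lia) i
    exact (ModuleCat.epi_iff_surjective _).1 inferInstance

/-- If a page of a square is a pullback along a morphism surjective on that page and on the next,
then the homology of the page is the pullback expected on the next page. -/
lemma isPullback_homology (hf : PagesSurjective f) {r r' : ℤ} (hr : r₀ ≤ r) (hrr' : r + 1 = r')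
    {Q : HomologicalComplex (ModuleCat.{v} R) (c r)} {a : Q ⟶ X.page r} {b : Q ⟶ Y.page r}
    (h : IsPullback a b (Hom.hom f r) (Hom.hom g r)) (i : κ) :
    IsPullback (HomologicalComplex.homologyMap a i ≫ (X.iso r r' i).hom)
      (HomologicalComplex.homologyMap b i ≫ (Y.iso r r' i).hom)
      ((Hom.hom f r').f i) ((Hom.hom g r').f i) :=
  IsPullback.of_iso (HomologicalComplex.isPullback_homologyMap h (hf r hr)
    (fun i => (surjective_homologyMap_iff f r r' hr hrr' i).2 (hf r' (by lia) i)) i)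
    (Iso.refl _) (X.iso r r' i) (Y.iso r r' i) (S.iso r r' i) (by simp) (by simp)
    (f.comm r r' i) (g.comm r r' i)

/-- A square of spectral sequences over a pagewise surjective morphism which is a pullback on the
first page is a pullback on each page. -/
lemma isPullback_page_of_first (hf : PagesSurjective f)
    (h : IsPullback (Hom.hom a r₀) (Hom.hom b r₀) (Hom.hom f r₀) (Hom.hom g r₀)) (r : ℤ)
    (hr : r₀ ≤ r) : IsPullback (Hom.hom a r) (Hom.hom b r) (Hom.hom f r) (Hom.hom g r) := by
  induction r, hr using Int.leInduction with
  | base => exact h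
  | succ r hr ih =>
    refine HomologicalComplex.isPullback_of_eval fun i => ?_
    -- The homology of page `r` of `P` is already the right pullback; the characteristic isomorphism
    -- of `P` transports this to page `r + 1`, compatibly with the projections because `a` and `b`
    -- are morphisms of spectral sequences.
    refine IsPullback.of_iso (isPullback_homology hf hr rfl ih i) (P.iso r (r + 1) i)
      (Iso.refl _) (Iso.refl _) (Iso.refl _) ?_ ?_ (by simp) (by simp)
    · rw [Iso.refl_hom, Category.comp_id]; exact a.comm r (r + 1) i
    · rw [Iso.refl_hom, Category.comp_id]; exact b.comm r (r + 1) i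

section Construction

variable (f g)

variable {f} in
/-- The isomorphism between the homology of a page of the fibre product and the next page. -/
def pullbackIso (hf : PagesSurjective f) (r r' : ℤ) (i : κ) (hrr' : r + 1 = r') (hr : r₀ ≤ r) :
    (Limits.pullback (Hom.hom f r) (Hom.hom g r)).homology i ≅
      (Limits.pullback (Hom.hom f r') (Hom.hom g r')).X i :=
  IsPullback.isoIsPullback _ _
    (isPullback_homology hf hr hrr' (IsPullback.of_hasPullback (Hom.hom f r) (Hom.hom g r)) i)
    (HomologicalComplex.isPullback_eval
      (IsPullback.of_hasPullback (Hom.hom f r') (Hom.hom g r')) i)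

variable {f} in
/-- The pagewise fibre product. -/
def pagewisePullback (hf : PagesSurjective f) : SpectralSequence (ModuleCat.{v} R) c r₀ where
  page r _ := Limits.pullback (Hom.hom f r) (Hom.hom g r)
  iso r r' i hrr' hr := pullbackIso g hf r r' i hrr' hr

variable {f} in
/-- The first projection from the pagewise fibre product. -/
def pagewisePullback.fst (hf : PagesSurjective f) : pagewisePullback g hf ⟶ X where
  hom r _ := Limits.pullback.fst (Hom.hom f r) (Hom.hom g r)
  -- The characteristic isomorphism was defined by comparing two pullbacks of the same diagram, so
  -- it commutes with the projections by construction.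
  comm _ _ _ _ _ := (IsPullback.isoIsPullback_hom_fst _ _ _ _).symm

variable {f} in
/-- The second projection from the pagewise fibre product. -/
def pagewisePullback.snd (hf : PagesSurjective f) : pagewisePullback g hf ⟶ Y where
  hom r _ := Limits.pullback.snd (Hom.hom f r) (Hom.hom g r)
  comm _ _ _ _ _ := (IsPullback.isoIsPullback_hom_snd _ _ _ _).symm

end Construction

lemma isPullback_pagewisePullback (hf : PagesSurjective f) :
    IsPullback (pagewisePullback.fst g hf) (pagewisePullback.snd g hf) f g :=
  isPullback_of_page fun _ _ => IsPullback.of_hasPullback _ _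

/-- Pullbacks along pagewise surjective morphisms are computed pagewise. -/
lemma isPullback_page (hf : PagesSurjective f) (h : IsPullback a b f g) (r : ℤ) (hr : r₀ ≤ r) :
    IsPullback (Hom.hom a r) (Hom.hom b r) (Hom.hom f r) (Hom.hom g r) := by
  -- Any pullback is isomorphic to the pagewise model, for which the claim holds by construction.
  let e := (isPullback_pagewisePullback (g := g) hf).isoIsPullback _ _ h
  refine IsPullback.of_iso (IsPullback.of_hasPullback (Hom.hom f r) (Hom.hom g r))
    ((pageFunctor _ _ _ r hr).mapIso e) (Iso.refl _) (Iso.refl _) (Iso.refl _) ?_ ?_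
    (by simp) (by simp)
  · rw [Iso.refl_hom, Category.comp_id]
    exact (congrArg (fun k : pagewisePullback g hf ⟶ _ => Hom.hom k r hr)
      (IsPullback.isoIsPullback_hom_fst X Y (isPullback_pagewisePullback (g := g) hf) h)).symm
  · rw [Iso.refl_hom, Category.comp_id]
    exact (congrArg (fun k : pagewisePullback g hf ⟶ _ => Hom.hom k r hr)
      (IsPullback.isoIsPullback_hom_snd X Y (isPullback_pagewisePullback (g := g) hf) h)).symm

lemma subsingleton_of_isZero (h : IsZero X) (r : ℤ) (hr : r₀ ≤ r) (i : κ) :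
    Subsingleton ((X.page r).X i) := by
  rw [← ModuleCat.isZero_iff_subsingleton]
  exact (HomologicalComplex.eval _ _ i).map_isZero ((pageFunctor _ _ _ r hr).map_isZero h)

lemma pagesSurjective_of_isZero (h : IsZero S) (f : X ⟶ S) : PagesSurjective f :=
  fun r hr i y => by
    have := subsingleton_of_isZero h r hr i
    exact ⟨0, Subsingleton.elim _ _⟩

/-- A binary product is a fibre product over the zero object; maps to zero are pagewise surjective,
so the pagewise construction applies. -/
instance : HasFiniteProducts (SpectralSequence (ModuleCat.{v} R) c r₀) := by
  have : HasBinaryProducts (SpectralSequence (ModuleCat.{v} R) c r₀) := by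
    have (X Y : SpectralSequence (ModuleCat.{v} R) c r₀) : HasBinaryProduct X Y :=
      ⟨⟨⟨BinaryFan.mk _ _, isBinaryProductOfIsTerminalIsPullback (pair X Y) _
        (isZero_zero _ _ _).isTerminal (0 : X ⟶ _) (0 : Y ⟶ _)
        (isPullback_pagewisePullback (g := (0 : Y ⟶ _))
          (pagesSurjective_of_isZero (isZero_zero _ _ _) (0 : X ⟶ _))).isLimit⟩⟩⟩
    exact hasBinaryProducts_of_hasLimit_pair _
  exact hasFiniteProducts_of_has_binary_and_terminal

end CategoryTheory.SpectralSequence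

/-! ### Homology recognised through an explicit linear map -/

namespace ModuleCat

variable {R : Type u} [CommRing R] {M N : ModuleCat.{v} R} (e : M ≅ N)

lemma iso_hom_inv_apply (y : N) : e.hom.hom (e.inv.hom y) = y :=
  congrArg (fun q => q.hom y) e.inv_hom_id

lemma iso_inv_hom_apply (x : M) : e.inv.hom (e.hom.hom x) = x :=
  congrArg (fun q => q.hom x) e.hom_inv_id

lemma eq_zero_of_iso {x : M} (h : e.hom.hom x = 0) : x = 0 := by
  rw [← iso_inv_hom_apply e x, h, map_zero]

end ModuleCat

namespace HomologicalComplex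

variable {R : Type u} [CommRing R] {ι : Type*} {c : ComplexShape ι}

section

variable (K : HomologicalComplex (ModuleCat.{v} R) c) {i : ι} {N : ModuleCat.{v} R}
  (φ : K.X i ⟶ N)
  (h₀ : ∀ x, (K.d i (c.next i)).hom x = 0 →
    (φ.hom x = 0 ↔ ∃ w, (K.d (c.prev i) i).hom w = x))

lemma toCycles_iCycles_eq_zero
    (h₀ : ∀ x, (K.d i (c.next i)).hom x = 0 →
      (φ.hom x = 0 ↔ ∃ w, (K.d (c.prev i) i).hom w = x)) :
    K.toCycles (c.prev i) i ≫ K.iCycles i ≫ φ = 0 := by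
  rw [toCycles_i_assoc]
  ext w
  exact (h₀ _ (d_d_elem K _ _ _ _)).2 ⟨w, rfl⟩

/-- The map induced in homology by a linear map vanishing on boundaries. -/
def homologyDesc : K.homology i ⟶ N :=
  (K.homologyIsCokernel _ i rfl).desc
    (CokernelCofork.ofπ (K.iCycles i ≫ φ) (K.toCycles_iCycles_eq_zero φ h₀))

lemma IsRep.homologyDesc_eq {x : K.X i} {h : K.homology i} (H : K.IsRep i x h) :
    (K.homologyDesc φ h₀).hom h = φ.hom x := by
  obtain ⟨z, rfl, rfl⟩ := H
  exact congrArg (fun k => k.hom z) ((K.homologyIsCokernel _ i rfl).fac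
    (CokernelCofork.ofπ (K.iCycles i ≫ φ) (K.toCycles_iCycles_eq_zero φ h₀))
      WalkingParallelPair.one)

/-- A linear map that is surjective on cycles and whose kernel on cycles consists of the
boundaries identifies the homology. -/
def homologyIsoOf (hs : ∀ y, ∃ x, (K.d i (c.next i)).hom x = 0 ∧ φ.hom x = y) :
    K.homology i ≅ N :=
  (LinearEquiv.ofBijective (K.homologyDesc φ h₀).hom (by
    constructor
    · rw [injective_iff_map_eq_zero]
      intro h hh
      obtain ⟨x, hx⟩ := K.exists_isRep i h
      rw [hx.homologyDesc_eq, h₀ x (hx.d_eq_zero _)] at hh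
      exact hx.eq (isRep_zero_iff.2 hh)
    · intro y
      obtain ⟨x, hx, rfl⟩ := hs y
      obtain ⟨h, hh⟩ := exists_homology_isRep hx
      exact ⟨h, hh.homologyDesc_eq K φ h₀⟩)).toModuleIso

lemma IsRep.homologyIsoOf_eq (hs : ∀ y, ∃ x, (K.d i (c.next i)).hom x = 0 ∧ φ.hom x = y)
    {x : K.X i} {h : K.homology i} (H : K.IsRep i x h) :
    (K.homologyIsoOf φ h₀ hs).hom.hom h = φ.hom x :=
  H.homologyDesc_eq K φ h₀

end

end HomologicalComplex

/-! ### Disc spectral sequences surjecting onto a given page -/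

namespace SpSe

open HomologicalComplex FilteredComplex

variable {R : Type u} [CommRing R] (Y : SpSe.{v} R)

/-- Families of elements of all the pages in all bidegrees. -/
abbrev Families : Type v := ∀ (i : ℤ × ℤ) (j : {j : ℤ // 0 ≤ j}), (Y.page j.1 j.2).X i

/-- The families `t` such that, for `j < k`, the element `t i j` of the `j`-page is a cycle
whose class is the element `t i (j + 1)` of the next page. -/
def towers (k : ℤ) : Submodule R Y.Families where
  -- Representatives of classes cannot in general be chosen linearly. Recording all possible choices
  -- gives a linear condition, hence a module. Entries on pages beyond `k` are unconstrained; they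
  -- play no role, since the disc vanishes there.
  carrier := {t | ∀ (i : ℤ × ℤ) (j j' : ℤ) (hj : 0 ≤ j) (h : j + 1 = j'), j < k →
    (Y.page j hj).IsRep i (t i ⟨j, hj⟩) ((Y.iso j j' i h hj).inv.hom (t i ⟨j', by lia⟩))}
  add_mem' hs ht i j j' hj h hk := by
    have := (hs i j j' hj h hk).add (ht i j j' hj h hk)
    rw [← map_add] at this
    exact this
  zero_mem' i j j' hj h hk := by
    have : (Y.page j hj).IsRep i 0 0 := isRep_zero
    rw [← map_zero (Y.iso j j' i h hj).inv.hom] at this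
    exact this
  smul_mem' a t ht i j j' hj h hk := by
    have := (ht i j j' hj h hk).smul a
    rw [← map_smul] at this
    exact this

/-- Representatives are chosen successively from page `k` down to page 0, in all bidegrees at once.
-/
lemma exists_tower (k : ℤ) (hk : 0 ≤ k) (y : ∀ i, (Y.page k hk).X i) :
    ∃ t ∈ Y.towers k, ∀ i, t i ⟨k, hk⟩ = y i := by
  classical
  induction k, hk using Int.leInduction with
  | base =>
    exact ⟨fun i => Function.update 0 ⟨0, le_rfl⟩ (y i),
      fun i j j' hj h hk => absurd hk (by lia), fun i => by simp⟩
  | succ k hk ih =>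
    choose z hz using fun i => (Y.page k hk).exists_isRep i
      ((Y.iso k (k + 1) i rfl hk).inv.hom (y i))
    obtain ⟨t, ht, htz⟩ := ih z
    -- The conditions for `j < k` involve only pages up to `k`, so changing the entry on page `k +
    -- 1` affects only the new condition `j = k`.
    refine ⟨fun i => Function.update (t i) ⟨k + 1, by lia⟩ (y i), ?_, fun i => by simp⟩
    intro i j j' hj h hjk
    change (Y.page j hj).IsRep i (Function.update (t i) ⟨k + 1, by lia⟩ (y i) ⟨j, hj⟩)
      ((Y.iso j j' i h hj).inv.hom (Function.update (t i) ⟨k + 1, by lia⟩ (y i) ⟨j', by lia⟩))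
    rw [Function.update_of_ne (by simp; lia)]
    by_cases hjk' : j < k
    · rw [Function.update_of_ne (by simp; lia)]
      exact ht i j j' hj h hjk'
    · obtain rfl : j = k := by lia
      subst h
      rw [Function.update_self, htz]
      exact hz i

variable (k : ℤ) (hk : 0 ≤ k)

/-- Pairs of towers up to page `k`, the second of which is the `k`-th differential of the first
on page `k`. -/
def witnesses : Submodule R (Y.Families × Y.Families) where
  carrier := {s | s.1 ∈ Y.towers k ∧ s.2 ∈ Y.towers k ∧ ∀ i i', (rShape k).Rel i i' →
    ((Y.page k hk).d i i').hom (s.1 i ⟨k, hk⟩) = s.2 i' ⟨k, hk⟩}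
  add_mem' hs ht := ⟨add_mem hs.1 ht.1, add_mem hs.2.1 ht.2.1, fun i i' h =>
    (map_add _ _ _).trans (congrArg₂ _ (hs.2.2 i i' h) (ht.2.2 i i' h))⟩
  zero_mem' := ⟨zero_mem _, zero_mem _, fun _ _ _ => map_zero _⟩
  smul_mem' a _ hs := ⟨Submodule.smul_mem _ a hs.1, Submodule.smul_mem _ a hs.2.1, fun i i' h =>
    (map_smul _ _ _).trans (congrArg _ (hs.2.2 i i' h))⟩

/-- The two towers are related only on page `k`, so the differential of the first can be lifted to
lower pages independently. -/
lemma exists_witness (i : ℤ × ℤ) (y : (Y.page k hk).X i) :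
    ∃ s ∈ Y.witnesses k hk, s.1 i ⟨k, hk⟩ = y := by
  classical
  obtain ⟨t, ht, hty⟩ := Y.exists_tower k hk (Pi.single i y)
  obtain ⟨w, hw, hwy⟩ := Y.exists_tower k hk fun i' =>
    ((Y.page k hk).d ((rShape k).prev i') i').hom (t _ ⟨k, hk⟩)
  refine ⟨(t, w), ⟨ht, hw, fun i i' h => ?_⟩, ?_⟩
  · obtain rfl := (rShape k).prev_eq' h
    exact (hwy i').symm
  · exact (hty i).trans (Pi.single_eq_same (M := fun i => (Y.page k hk).X i) i y)

/-- The module in each bidegree of the `j`-page of the disc on the witnesses: it vanishes for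
`k < j`. -/
def discX (j : ℤ) : Submodule R (Y.witnesses k hk × Y.witnesses k hk) where
  -- The condition is empty for `j ≤ k`; all pages are thus submodules of one module, and maps
  -- between them need no case split on types.
  carrier := {m | k < j → m = 0}
  add_mem' hs ht h := by rw [hs h, ht h, add_zero]
  zero_mem' _ := rfl
  smul_mem' a s hs h := by rw [hs h, smul_zero]

/-- The nonzero differential `(s, s') ↦ (0, s)` of the disc. -/
def discD (j : ℤ) : Y.discX k hk j →ₗ[R] Y.discX k hk j :=
  (LinearMap.inr R _ _ ∘ₗ LinearMap.fst R _ _).restrict (fun m hm h => by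
    rw [hm h]; simp)

open scoped Classical in
/-- The `j`-page of the disc: the differential is nonzero only for `j = k`. -/
def discPage (j : ℤ) : BigradedComplex.{v} R j where
  X _ := ModuleCat.of R (Y.discX k hk j)
  d i i' := if (rShape j).Rel i i' ∧ j = k then ModuleCat.ofHom (Y.discD k hk j) else 0
  shape i i' h := if_neg fun h' => h h'.1
  d_comp_d' i i' i'' h h' := by
    by_cases hjk : j = k
    · rw [if_pos ⟨h, hjk⟩, if_pos ⟨h', hjk⟩]
      refine ModuleCat.hom_ext (LinearMap.ext fun m => ?_)
      exact Subtype.ext rfl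
    · rw [if_neg fun h => hjk h.2, zero_comp]

lemma discPage_d_of_ne {j : ℤ} (h : j ≠ k) (i i' : ℤ × ℤ) : (Y.discPage k hk j).d i i' = 0 :=
  if_neg fun h' => h h'.2

lemma discPage_d {i i' : ℤ × ℤ} (h : (rShape k).Rel i i') :
    (Y.discPage k hk k).d i i' = ModuleCat.ofHom (Y.discD k hk k) :=
  if_pos ⟨h, rfl⟩

lemma discX_eq_zero {j : ℤ} (h : k < j) (m : Y.discX k hk j) : m = 0 :=
  Subtype.ext (m.2 h)

open scoped Classical in
/-- The map from a page of the disc to the next. -/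
def discNext (j j' : ℤ) (h : j + 1 = j') : Y.discX k hk j →ₗ[R] Y.discX k hk j' :=
  if hj : j < k then Submodule.inclusion (fun m _ hk => absurd hk (by lia)) else 0

lemma discNext_of_lt {j j' : ℤ} (h : j + 1 = j') (hj : j < k) (m : Y.discX k hk j) :
    (Y.discNext k hk j j' h m : Y.witnesses k hk × Y.witnesses k hk) = m := by
  rw [discNext, dif_pos hj]; rfl

lemma discNext_of_ge {j j' : ℤ} (h : j + 1 = j') (hj : ¬ j < k) (m : Y.discX k hk j) :
    Y.discNext k hk j j' h m = 0 := by
  rw [discNext, dif_neg hj]; rfl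

/-- `discNext` as a morphism between the modules of the pages. -/
def discNextHom (j j' : ℤ) (h : j + 1 = j') (i : ℤ × ℤ) :
    (Y.discPage k hk j).X i ⟶ (Y.discPage k hk j').X i :=
  ModuleCat.ofHom (X := Y.discX k hk j) (Y := Y.discX k hk j') (Y.discNext k hk j j' h)

/-- There are three regimes. Below page `k` the differentials vanish and `discNext` is injective. On
page `k` the differential `(s, s') ↦ (0, s)` has kernel equal to its image, and the next page is
zero. Above `k` everything is zero. -/
lemma discNext_eq_zero_iff {j j' : ℤ} (h : j + 1 = j') (i : ℤ × ℤ)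
    (m : (Y.discPage k hk j).X i)
    (hm : ((Y.discPage k hk j).d i ((rShape j).next i)).hom m = 0) :
    (Y.discNextHom k hk j j' h i).hom m = 0 ↔
      ∃ w, ((Y.discPage k hk j).d ((rShape j).prev i) i).hom w = m := by
  rcases lt_trichotomy j k with hjk | rfl | hjk
  · rw [discPage_d_of_ne _ _ _ hjk.ne]
    constructor
    · intro h0
      refine ⟨0, (Subtype.ext ?_ : (0 : Y.discX k hk j) = m)⟩
      rw [← Y.discNext_of_lt k hk h hjk m]
      exact congrArg Subtype.val h0.symm
    · rintro ⟨w, hw⟩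
      have : m = 0 := hw.symm
      rw [this, map_zero]
  · rw [discPage_d _ _ _ (rel_next j i)] at hm
    rw [discPage_d _ _ _ (rel_prev j i)]
    have hm1 : (m : Y.discX j hk j).1.1 = 0 :=
      congrArg (fun x : Y.discX j hk j => x.1.2) hm
    refine iff_of_true (Y.discNext_of_ge j hk h (lt_irrefl j) m)
      ⟨(⟨((m : Y.discX j hk j).1.2, 0), fun h => absurd h (lt_irrefl j)⟩ : Y.discX j hk j), ?_⟩
    exact Subtype.ext (Prod.ext hm1.symm rfl)
  · rw [Y.discX_eq_zero k hk hjk m]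
    exact iff_of_true (map_zero _) ⟨0, map_zero _⟩

lemma discNext_surjective {j j' : ℤ} (h : j + 1 = j') (i : ℤ × ℤ) (y : Y.discX k hk j') :
    ∃ m, ((Y.discPage k hk j).d i ((rShape j).next i)).hom m = 0 ∧
      (Y.discNextHom k hk j j' h i).hom m = y := by
  by_cases hjk : j < k
  · refine ⟨(⟨y.1, fun h => absurd h (by lia)⟩ : Y.discX k hk j), ?_, ?_⟩
    · rw [discPage_d_of_ne _ _ _ hjk.ne]; rfl
    · exact Subtype.ext (Y.discNext_of_lt k hk h hjk _)
  · refine ⟨0, map_zero _, ?_⟩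
    exact (map_zero (Y.discNextHom k hk j j' h i).hom).trans
      (Y.discX_eq_zero k hk (by lia) y).symm

/-- The disc on the witnesses: a spectral sequence whose `k`-page is acyclic. -/
def disc : SpSe.{v} R where
  page j _ := Y.discPage k hk j
  iso j j' i h _ := (Y.discPage k hk j).homologyIsoOf (Y.discNextHom k hk j j' h i)
    (Y.discNext_eq_zero_iff k hk h i) (Y.discNext_surjective k hk h i)

/-- The linear map underlying the morphism from the disc, `(s, s') ↦ s.1 + s'.2`. -/
def discEval (j : ℤ) (hj : 0 ≤ j) (i : ℤ × ℤ) : Y.discX k hk j →ₗ[R] (Y.page j hj).X i where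
  toFun m := m.1.1.1.1 i ⟨j, hj⟩ + m.1.2.1.2 i ⟨j, hj⟩
  map_add' _ _ := add_add_add_comm _ _ _ _
  map_smul' a m := (smul_add a (m.1.1.1.1 i ⟨j, hj⟩) (m.1.2.1.2 i ⟨j, hj⟩)).symm

lemma d_discEval (j : ℤ) (hj : 0 ≤ j) (i i' : ℤ × ℤ) (m : Y.discX k hk j) :
    ((Y.page j hj).d i i').hom (Y.discEval k hk j hj i m) =
      ((Y.page j hj).d i i').hom (m.1.1.1.1 i ⟨j, hj⟩) +
        ((Y.page j hj).d i i').hom (m.1.2.1.2 i ⟨j, hj⟩) :=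
  map_add _ _ _

/-- Below page `k` the entries of towers are cycles, matching the zero differential of the disc. On
page `k`, `d` takes `s.1` to `s.2`, while `s'.2` is itself a differential and is killed, matching
`(s, s') ↦ (0, s)`. -/
lemma discEval_comm (j : ℤ) (hj : 0 ≤ j) (i i' : ℤ × ℤ) (h : (rShape j).Rel i i')
    (m : Y.discX k hk j) :
    ((Y.page j hj).d i i').hom (Y.discEval k hk j hj i m) =
      Y.discEval k hk j hj i' (((Y.discPage k hk j).d i i').hom m) := by
  rcases lt_trichotomy j k with hjk | rfl | hjk
  · rw [discPage_d_of_ne _ _ _ hjk.ne]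
    refine Eq.trans ?_ (map_zero (Y.discEval k hk j hj i')).symm
    rw [d_discEval, (m.1.1.2.1 i j _ hj rfl hjk).d_eq_zero,
      (m.1.2.2.2.1 i j _ hj rfl hjk).d_eq_zero, add_zero]
  · rw [discPage_d _ _ _ h, d_discEval, m.1.1.2.2.2 i i' h, ← m.1.2.2.2.2 _ i (rel_prev j i),
      d_d_elem]
    exact add_comm _ _
  · rw [Y.discX_eq_zero k hk hjk m]
    have h1 : ((Y.discPage k hk j).d i i').hom (0 : Y.discX k hk j) = (0 : Y.discX k hk j) :=
      map_zero _
    rw [h1, map_zero, map_zero, map_zero]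

lemma isRep_discEval {j j' : ℤ} (hj : 0 ≤ j) (h : j + 1 = j') (hjk : j < k) (i : ℤ × ℤ)
    (m : Y.discX k hk j) :
    (Y.page j hj).IsRep i (Y.discEval k hk j hj i m)
      ((Y.iso j j' i h hj).inv.hom
        (Y.discEval k hk j' (by lia) i (Y.discNext k hk j j' h m))) := by
  have := (m.1.1.2.1 i j _ hj h hjk).add (m.1.2.2.2.1 i j _ hj h hjk)
  rw [← map_add] at this
  rw [discNext, dif_pos hjk]
  exact this

/-- The morphism of pages from the disc on the witnesses. -/
def discPageHom (j : ℤ) (hj : 0 ≤ j) : Y.discPage k hk j ⟶ Y.page j hj where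
  f i := ModuleCat.ofHom (Y.discEval k hk j hj i)
  comm' i i' h := by
    refine ModuleCat.hom_ext (LinearMap.ext fun m => ?_)
    exact Y.discEval_comm k hk j hj i i' h m

lemma disc_iso_apply {j j' : ℤ} (h : j + 1 = j') (hj : 0 ≤ j) {i : ℤ × ℤ}
    {m : Y.discX k hk j} {x : (Y.discPage k hk j).homology i}
    (hm : (Y.discPage k hk j).IsRep i m x) :
    ((Y.disc k hk).iso j j' i h hj).hom.hom x = Y.discNext k hk j j' h m :=
  hm.homologyIsoOf_eq _ _ (Y.discNext_eq_zero_iff k hk h i) (Y.discNext_surjective k hk h i)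

/-- For `j < k` this is the tower condition, read on a representative. For `j ≥ k` the next page of
the disc vanishes, hence so does the homology class. -/
lemma discPageHom_homology {j j' : ℤ} (h : j + 1 = j') (hj : 0 ≤ j) (i : ℤ × ℤ)
    (x : (Y.discPage k hk j).homology i) :
    (Y.iso j j' i h hj).hom.hom ((homologyMap (Y.discPageHom k hk j hj) i).hom x) =
      Y.discEval k hk j' (by lia) i (((Y.disc k hk).iso j j' i h hj).hom.hom x) := by
  obtain ⟨m, hm⟩ := (Y.discPage k hk j).exists_isRep i x
  have hx := Y.disc_iso_apply k hk h hj hm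
  by_cases hjk : j < k
  · rw [hx, (hm.map (Y.discPageHom k hk j hj)).eq (Y.isRep_discEval k hk hj h hjk i m)]
    exact ModuleCat.iso_hom_inv_apply _ _
  · have hx0 : ((Y.disc k hk).iso j j' i h hj).hom.hom x = (0 : Y.discX k hk j') :=
      hx.trans (Y.discNext_of_ge k hk h hjk m)
    have : x = 0 := ModuleCat.eq_zero_of_iso _ hx0
    rw [hx0, this, map_zero, map_zero, map_zero]

/-- The morphism from the disc on the witnesses. -/
def discHom : Y.disc k hk ⟶ Y where
  hom j hj := Y.discPageHom k hk j hj
  comm j j' i h hj := by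
    refine ModuleCat.hom_ext (LinearMap.ext fun x => ?_)
    exact Y.discPageHom_homology k hk h hj i x

lemma discHom_surjective (i : ℤ × ℤ) :
    Function.Surjective ((SpectralSequence.Hom.hom (Y.discHom k hk) k).f i) := by
  intro y
  obtain ⟨s, hs, rfl⟩ := Y.exists_witness k hk i y
  exact ⟨(⟨(⟨s, hs⟩, 0), fun h => absurd h (lt_irrefl k)⟩ : Y.discX k hk k), add_zero _⟩

lemma isZero_disc_page (j : ℤ) (hj : 0 ≤ j) (hkj : k < j) (i : ℤ × ℤ) :
    IsZero (((Y.disc k hk).page j hj).X i) :=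
  have : Subsingleton (Y.discX k hk j) :=
    ⟨fun a b => (Y.discX_eq_zero k hk hkj a).trans (Y.discX_eq_zero k hk hkj b).symm⟩
  ModuleCat.isZero_of_subsingleton (ModuleCat.of R (Y.discX k hk j))

end SpSe

/-! ### Filtered complexes: additive structure, fibre products and path objects -/

namespace FilteredComplex

variable {R : Type u} [CommRing R]

section Preadditive

variable {A B : FilteredComplex.{v} R}

instance : Zero (A ⟶ B) where
  zero := { map := 0, map_mem := fun _ _ _ _ => zero_mem _ }

instance : Add (A ⟶ B) where
  add f g := { map := f.map + g.map
               map_mem := fun p n x hx => add_mem (f.map_mem p n x hx) (g.map_mem p n x hx) }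

instance : Neg (A ⟶ B) where
  neg f := { map := -f.map
             map_mem := fun p n x hx => neg_mem (f.map_mem p n x hx) }

instance : AddCommGroup (A ⟶ B) where
  add_assoc _ _ _ := hom_ext (add_assoc _ _ _)
  zero_add _ := hom_ext (zero_add _)
  add_zero _ := hom_ext (add_zero _)
  add_comm _ _ := hom_ext (add_comm _ _)
  neg_add_cancel _ := hom_ext (neg_add_cancel _)
  nsmul := nsmulRec
  zsmul := zsmulRec

instance : Preadditive (FilteredComplex.{v} R) where
  add_comp _ _ _ _ _ _ := hom_ext (Preadditive.add_comp _ _ _ _ _ _)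
  comp_add _ _ _ _ _ _ := hom_ext (Preadditive.comp_add _ _ _ _ _ _)

/-- Additivity is what makes `E` preserve finite products, and what lets `E` be tested on biproducts
in the factorization. -/
instance : (spectralSequence.{v} R).Additive where
  map_add {A B f g} := by
    refine SpectralSequence.hom_ext fun r hr => ?_
    ext i x
    obtain ⟨z, rfl⟩ := Submodule.mkQ_surjective _ x
    rfl

end Preadditive

variable (R) in
/-- The zero filtered complex. -/
def zero : FilteredComplex.{v} R where
  cpx := (HasZeroObject.zero (C := CochainComplex (ModuleCat.{v} R) ℤ)).choose
  F _ _ := ⊤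
  F_mono _ _ := le_rfl
  d_mem _ _ _ _ := trivial

variable (R) in
lemma isZero_zero : IsZero (zero.{v} R) := by
  rw [IsZero.iff_id_eq_zero]
  exact hom_ext
    ((HasZeroObject.zero (C := CochainComplex (ModuleCat.{v} R) ℤ)).choose_spec.eq_of_src _ _)

instance : HasZeroObject (FilteredComplex.{v} R) := ⟨_, isZero_zero R⟩

lemma subsingleton_of_isZero {A : FilteredComplex.{v} R} (h : IsZero A) (n : ℤ) :
    Subsingleton (A.cpx.X n) :=
  ⟨fun x y => by
    have h0 : (𝟙 A : A ⟶ A) = 0 := h.eq_of_src _ _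
    have := fun x : A.cpx.X n => congrArg (fun q : A ⟶ A => (q.map.f n).hom x) h0
    exact (this x).trans (this y).symm⟩

section Pullback

variable {P A U B : FilteredComplex.{v} R} {a : P ⟶ A} {b : P ⟶ U} (f : A ⟶ B) (g : U ⟶ B)

/-- The fibre product of filtered complexes. -/
def fiberProduct : FilteredComplex.{v} R where
  cpx := Limits.pullback f.map g.map
  F p n := (A.F p n).comap ((Limits.pullback.fst f.map g.map).f n).hom ⊓
    (U.F p n).comap ((Limits.pullback.snd f.map g.map).f n).hom
  F_mono p n := inf_le_inf (Submodule.comap_mono (A.F_mono p n))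
    (Submodule.comap_mono (U.F_mono p n))
  d_mem p n x hx := by
    constructor
    · change ((Limits.pullback.fst f.map g.map).f (n + 1)).hom _ ∈ A.F p (n + 1)
      rw [← HomologicalComplex.hom_d_apply]
      exact A.d_mem p n _ hx.1
    · change ((Limits.pullback.snd f.map g.map).f (n + 1)).hom _ ∈ U.F p (n + 1)
      rw [← HomologicalComplex.hom_d_apply]
      exact U.d_mem p n _ hx.2

/-- The first projection from the fibre product. -/
def fiberProduct.fst : fiberProduct f g ⟶ A where
  map := Limits.pullback.fst f.map g.map
  map_mem _ _ _ hx := hx.1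

/-- The second projection from the fibre product. -/
def fiberProduct.snd : fiberProduct f g ⟶ U where
  map := Limits.pullback.snd f.map g.map
  map_mem _ _ _ hx := hx.2

lemma isPullback_fiberProduct : IsPullback (fiberProduct.fst f g) (fiberProduct.snd f g) f g := by
  have H := IsPullback.of_hasPullback f.map g.map
  have w : fiberProduct.fst f g ≫ f = fiberProduct.snd f g ≫ g := hom_ext H.w
  have key (s : PullbackCone f g) : s.fst.map ≫ f.map = s.snd.map ≫ g.map := by
    rw [← comp_map, s.condition, comp_map]
  have h1 (s : PullbackCone f g) := H.lift_fst _ _ (key s)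
  have h2 (s : PullbackCone f g) := H.lift_snd _ _ (key s)
  refine ⟨⟨w⟩, ⟨PullbackCone.IsLimit.mk w
    (fun s => { map := H.lift s.fst.map s.snd.map (key s)
                map_mem := fun p n x hx => ⟨?_, ?_⟩ })
    (fun s => hom_ext (h1 s)) (fun s => hom_ext (h2 s)) (fun s m e1 e2 => hom_ext ?_)⟩⟩
  · change ((H.lift _ _ (key s) ≫ Limits.pullback.fst f.map g.map).f n).hom x ∈ A.F p n
    rw [h1 s]
    exact s.fst.map_mem p n x hx
  · change ((H.lift _ _ (key s) ≫ Limits.pullback.snd f.map g.map).f n).hom x ∈ U.F p n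
    rw [h2 s]
    exact s.snd.map_mem p n x hx
  · apply H.hom_ext
    · exact (congrArg (fun q => Hom.map q) e1).trans (h1 s).symm
    · exact (congrArg (fun q => Hom.map q) e2).trans (h2 s).symm

variable {f g}

lemma isPullback_map (h : IsPullback a b f g) : IsPullback a.map b.map f.map g.map := by
  let e := (isPullback_fiberProduct f g).isoIsPullback _ _ h
  let e' : (fiberProduct f g).cpx ≅ P.cpx :=
    { hom := e.hom.map
      inv := e.inv.map
      hom_inv_id := congrArg Hom.map e.hom_inv_id
      inv_hom_id := congrArg Hom.map e.inv_hom_id }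
  refine IsPullback.of_iso (IsPullback.of_hasPullback f.map g.map) e' (Iso.refl _) (Iso.refl _)
    (Iso.refl _) ?_ ?_ (by simp) (by simp)
  · rw [Iso.refl_hom, Category.comp_id]
    exact (congrArg Hom.map (IsPullback.isoIsPullback_hom_fst _ _
      (isPullback_fiberProduct f g) h)).symm
  · rw [Iso.refl_hom, Category.comp_id]
    exact (congrArg Hom.map (IsPullback.isoIsPullback_hom_snd _ _
      (isPullback_fiberProduct f g) h)).symm

/-- The filtration of a pullback is the one induced from the two factors. -/
lemma mem_F_of_isPullback (h : IsPullback a b f g) {p n : ℤ} {x : P.cpx.X n}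
    (ha : (a.map.f n).hom x ∈ A.F p n) (hb : (b.map.f n).hom x ∈ U.F p n) : x ∈ P.F p n := by
  let e := (isPullback_fiberProduct f g).isoIsPullback _ _ h
  have h3 : (e.inv.map.f n).hom x ∈ (fiberProduct f g).F p n := by
    constructor
    · change ((e.inv ≫ fiberProduct.fst f g).map.f n).hom x ∈ A.F p n
      rwa [IsPullback.isoIsPullback_inv_fst]
    · change ((e.inv ≫ fiberProduct.snd f g).map.f n).hom x ∈ U.F p n
      rwa [IsPullback.isoIsPullback_inv_snd]
  have h4 := congrArg (fun q : P ⟶ P => (q.map.f n).hom x) e.inv_hom_id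
  exact Set.mem_of_eq_of_mem h4.symm (e.hom.map_mem p n _ h3)

lemma exists_mem_F_of_isPullback (h : IsPullback a b f g) {p n : ℤ} {x : A.cpx.X n}
    (hx : x ∈ A.F p n) {y : U.cpx.X n} (hy : y ∈ U.F p n)
    (hxy : (f.map.f n).hom x = (g.map.f n).hom y) :
    ∃ z ∈ P.F p n, (a.map.f n).hom z = x ∧ (b.map.f n).hom z = y := by
  obtain ⟨z, rfl, rfl⟩ := (ModuleCat.isPullback_iff_elementwise.1
    (HomologicalComplex.isPullback_eval (isPullback_map h) n)).2.2 x y hxy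
  exact ⟨z, mem_F_of_isPullback h hx hy, rfl, rfl⟩

/-- Fibrations of filtered complexes induce surjections on each step of the filtration. -/
def FSurjective (f : A ⟶ B) : Prop := ∀ p n : ℤ, Function.Surjective (mapZ f 0 p n)

lemma FSurjective.exists_mem (hf : FSurjective f) {p n : ℤ} {y : B.cpx.X n} (hy : y ∈ B.F p n) :
    ∃ x ∈ A.F p n, (f.map.f n).hom x = y := by
  rw [← Z_zero] at hy
  obtain ⟨⟨x, hx⟩, e⟩ := hf p n ⟨y, hy⟩
  rw [Z_zero] at hx
  exact ⟨x, hx, congrArg Subtype.val e⟩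

lemma fSurjective_of_exists
    (h : ∀ (p n : ℤ), ∀ y ∈ B.F p n, ∃ x ∈ A.F p n, (f.map.f n).hom x = y) : FSurjective f := by
  rintro p n ⟨y, hy⟩
  have hy' := hy
  rw [Z_zero] at hy'
  obtain ⟨x, hx, rfl⟩ := h p n y hy'
  rw [← Z_zero] at hx
  exact ⟨⟨x, hx⟩, rfl⟩

lemma FSurjective.of_isPullback (hf : FSurjective f) (h : IsPullback a b f g) :
    FSurjective b := by
  refine fSurjective_of_exists fun p n y hy => ?_
  obtain ⟨x, hx, e⟩ := hf.exists_mem (g.map_mem p n y hy)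
  obtain ⟨z, hz, -, rfl⟩ := exists_mem_F_of_isPullback h hx hy e
  exact ⟨z, hz, rfl⟩

/-- The 0-page is `F_p / F_{p-1}`, and each `F_p` of the pullback is the fibre product of the `F_p`
of the factors. Passing to the quotient costs an error in `F_{p-1} B`, which is absorbed by lifting
it to `F_{p-1} A`. -/
lemma isPullback_page_zero (hf : FSurjective f) (h : IsPullback a b f g) :
    IsPullback (pageMap a 0) (pageMap b 0) (pageMap f 0) (pageMap g 0) := by
  have w (n : ℤ) (z : P.cpx.X n) :
      (f.map.f n).hom ((a.map.f n).hom z) = (g.map.f n).hom ((b.map.f n).hom z) :=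
    congrArg (fun q : P ⟶ B => (q.map.f n).hom z) h.w
  refine HomologicalComplex.isPullback_of_eval fun i => ?_
  obtain ⟨p, n, hn⟩ : ∃ p n, p = i.1 ∧ n = i.2 - i.1 := ⟨_, _, rfl, rfl⟩
  suffices IsPullback (ModuleCat.ofHom (pageMapX a 0 p n)) (ModuleCat.ofHom (pageMapX b 0 p n))
      (ModuleCat.ofHom (pageMapX f 0 p n)) (ModuleCat.ofHom (pageMapX g 0 p n)) by
    obtain ⟨rfl, rfl⟩ := hn
    exact this
  refine ModuleCat.isPullback_iff_elementwise.2 ⟨?_, ?_, ?_⟩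
  · refine ModuleCat.hom_ext (LinearMap.ext fun z => ?_)
    obtain ⟨z, rfl⟩ := Submodule.mkQ_surjective _ z
    exact congrArg (B.cls 0 p n) (Subtype.ext (w n z))
  · intro z h1 h2
    obtain ⟨z, rfl⟩ := Submodule.mkQ_surjective _ z
    have h1' := (cls_eq_zero_iff (mapZ a 0 p n z)).1 h1
    have h2' := (cls_eq_zero_iff (mapZ b 0 p n z)).1 h2
    refine (cls_eq_zero_iff z).2 ?_
    rw [Bdry_zero, Z_zero] at h1' h2' ⊢
    exact mem_F_of_isPullback h h1' h2'
  · intro x y hxy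
    obtain ⟨x, rfl⟩ := Submodule.mkQ_surjective _ x
    obtain ⟨y, rfl⟩ := Submodule.mkQ_surjective _ y
    have hxy' : B.cls 0 p n (mapZ g 0 p n y - mapZ f 0 p n x) = 0 := by
      rw [map_sub, sub_eq_zero]
      exact hxy.symm
    rw [cls_eq_zero_iff, Bdry_zero, Z_zero] at hxy'
    -- Adding `t` does not change the class of `x`, and makes its image in `B` equal to that of `y`.
    obtain ⟨t, ht, e⟩ := hf.exists_mem hxy'
    have hxF : (x : A.cpx.X n) ∈ A.F p n := x.2.1
    have hyF : (y : U.cpx.X n) ∈ U.F p n := y.2.1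
    obtain ⟨z, hz, hz1, hz2⟩ := exists_mem_F_of_isPullback h
      (add_mem hxF (A.F_mono p n ht)) hyF (by
        rw [map_add, e]
        exact add_sub_cancel _ _)
    rw [← Z_zero] at hz
    refine ⟨P.cls 0 p n ⟨z, hz⟩, ?_, ?_⟩
    · rw [← sub_eq_zero]
      have h3 : A.cls 0 p n (mapZ a 0 p n ⟨z, hz⟩ - x) = 0 := by
        rw [cls_eq_zero_iff, Bdry_zero, Z_zero]
        change (a.map.f n).hom z - (x : A.cpx.X n) ∈ _
        rw [hz1, add_sub_cancel_left]
        exact ht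
      rw [map_sub] at h3
      exact h3
    · exact congrArg (U.cls 0 p n) (Subtype.ext hz2)

end Pullback

instance : HasFiniteProducts (FilteredComplex.{v} R) := by
  have : HasBinaryProducts (FilteredComplex.{v} R) := by
    have (X Y : FilteredComplex.{v} R) : HasBinaryProduct X Y :=
      ⟨⟨⟨BinaryFan.mk _ _, isBinaryProductOfIsTerminalIsPullback (pair X Y) _
        (isZero_zero R).isTerminal (0 : X ⟶ _) (0 : Y ⟶ _)
        (isPullback_fiberProduct (0 : X ⟶ _) (0 : Y ⟶ _)).isLimit⟩⟩⟩
    exact hasBinaryProducts_of_hasLimit_pair _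
  exact hasFiniteProducts_of_has_binary_and_terminal

section Path

lemma F_le {A : FilteredComplex.{v} R} {p q : ℤ} (h : p ≤ q) (n : ℤ) : A.F p n ≤ A.F q n := by
  induction q, h using Int.leInduction with
  | base => exact le_rfl
  | succ q _ ih => exact ih.trans (F_mono' _ _ _ (by lia))

lemma Z_le {A : FilteredComplex.{v} R} (k : ℤ) {p q : ℤ} (h : p ≤ q) (n : ℤ) :
    A.Z k p n ≤ A.Z k q n :=
  inf_le_inf (F_le h n) (Submodule.comap_mono (F_le (by lia) _))

variable (B : FilteredComplex.{v} R)

/-- The contractible complex with `V × V` in each degree, where `V = ∏ₙ Bⁿ`, and differential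
`(v, w) ↦ (0, v)`. -/
def pathCpx : CochainComplex (ModuleCat.{v} R) ℤ where
  X _ := ModuleCat.of R ((∀ n, B.cpx.X n) × (∀ n, B.cpx.X n))
  d i j := if i + 1 = j then
    ModuleCat.ofHom (LinearMap.inr R _ _ ∘ₗ LinearMap.fst R _ _) else 0
  shape i j h := if_neg h
  d_comp_d' i j k h h' := by
    rw [if_pos (show i + 1 = j from h), if_pos (show j + 1 = k from h')]
    rfl

lemma pathCpx_d (n n' : ℤ) (h : n + 1 = n') (v w : ∀ n, B.cpx.X n) :
    (B.pathCpx.d n n').hom (v, w) = ((0, v) : (∀ n, B.cpx.X n) × (∀ n, B.cpx.X n)) := by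
  have : B.pathCpx.d n n' = ModuleCat.ofHom (LinearMap.inr R _ _ ∘ₗ LinearMap.fst R _ _) :=
    if_pos h
  rw [this]
  rfl

/-- The path object on the `k`-cycles of `B`. -/
def path (k : ℤ) (hk : 0 ≤ k) : FilteredComplex.{v} R where
  cpx := B.pathCpx
  -- In degree `n` only the coordinates `v n` and `w (n - 1)` are constrained; the others are free
  -- and die on the pages, as they lie in every filtration step. The shift by `k` makes the
  -- differential `(v, w) ↦ (0, v)` lower the filtration by `k`, and puts `d w` in `F_p B` when `w`
  -- is a `k`-cycle of filtration `p + k`.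
  F p n := ((B.Z k p n).comap (LinearMap.proj n)).prod
    ((B.Z k (p + k) (n - 1)).comap (LinearMap.proj (n - 1)))
  F_mono p n := Submodule.prod_mono (Submodule.comap_mono (Z_le _ (by lia) _))
    (Submodule.comap_mono (Z_le _ (by lia) _))
  d_mem p n := by
    rintro ⟨v, w⟩ ⟨h1, -⟩
    rw [pathCpx_d _ _ _ rfl]
    refine ⟨zero_mem _, ?_⟩
    change v (n + 1 - 1) ∈ B.Z k (p + k) (n + 1 - 1)
    rw [add_sub_cancel_right]
    exact Z_le _ (by lia) _ h1

variable {B} {k : ℤ} {hk : 0 ≤ k}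

lemma mem_path_F {p n : ℤ} {v w : ∀ n, B.cpx.X n} :
    ((v, w) : (∀ n, B.cpx.X n) × (∀ n, B.cpx.X n)) ∈ (B.path k hk).F p n ↔
      v n ∈ B.Z k p n ∧ w (n - 1) ∈ B.Z k (p + k) (n - 1) := Iff.rfl

lemma mem_path_Z {j p n : ℤ} {v w : ∀ n, B.cpx.X n} :
    ((v, w) : (∀ n, B.cpx.X n) × (∀ n, B.cpx.X n)) ∈ (B.path k hk).Z j p n ↔
      (v n ∈ B.Z k p n ∧ w (n - 1) ∈ B.Z k (p + k) (n - 1)) ∧ v n ∈ B.Z k (p - j + k) n := by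
  refine and_congr mem_path_F ?_
  change (B.pathCpx.d n (n + 1)).hom (v, w) ∈ (B.path k hk).F (p - j) (n + 1) ↔ _
  rw [pathCpx_d _ _ _ rfl]
  refine mem_path_F.trans ?_
  rw [add_sub_cancel_right]
  exact and_iff_right (zero_mem (B.Z k (p - j) (n + 1)))

/-- Here `(v, w) = (v, 0) + d (w, 0)`. For `j > k` the cycle condition pushes `v` down to filtration
`p - j + k ≤ p - 1`, and `w` has filtration `p + k ≤ p + j - 1`, as the two summands of `Bdry`
require. -/
lemma path_Z_le_Bdry {j : ℤ} (hj : k < j) (p n : ℤ) :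
    (B.path k hk).Z j p n ≤ (B.path k hk).Bdry j p n := by
  rintro ⟨v, w⟩ h
  obtain ⟨⟨-, h2⟩, h3⟩ := mem_path_Z.1 h
  refine (mem_Bdry (A := B.path k hk) (n' := n - 1) (by lia) rfl).2
    ⟨((v, 0) : (∀ n, B.cpx.X n) × (∀ n, B.cpx.X n)),
    mem_path_Z.2 ⟨⟨Z_le _ (by lia) _ h3, zero_mem _⟩, Z_le _ (by lia) _ h3⟩,
    ((w, 0) : (∀ n, B.cpx.X n) × (∀ n, B.cpx.X n)), mem_path_Z.2
    ⟨⟨Z_le _ (by lia) _ h2, zero_mem _⟩, Z_le _ (by lia) _ h2⟩, ?_⟩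
  refine (congrArg _ (pathCpx_d _ (n - 1) n (by lia) w 0)).trans ?_
  exact Prod.ext (add_zero v) (zero_add w)

lemma isZero_path_page {j : ℤ} (hj : k < j) (i : ℤ × ℤ) :
    IsZero (((B.path k hk).page j).X i) := by
  have : Subsingleton ((B.path k hk).PageX j i.1 (i.2 - i.1)) := by
    refine ⟨fun x y => ?_⟩
    rw [← sub_eq_zero]
    obtain ⟨z, hz⟩ := Submodule.mkQ_surjective _ (x - y)
    rw [← hz]
    exact (cls_eq_zero_iff z).2 (path_Z_le_Bdry hj _ _ z.2)
  exact ModuleCat.isZero_of_subsingleton (ModuleCat.of R ((B.path k hk).PageX j _ _))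

variable (B k hk) in
/-- The linear map `(v, w) ↦ v + d w`. -/
def pathEval (n : ℤ) : (∀ n, B.cpx.X n) × (∀ n, B.cpx.X n) →ₗ[R] B.cpx.X n :=
  (LinearMap.proj n).coprod ((B.cpx.d (n - 1) n).hom ∘ₗ LinearMap.proj (n - 1))

lemma pathEval_apply (n : ℤ) (v w : ∀ n, B.cpx.X n) :
    B.pathEval n (v, w) = v n + (B.cpx.d (n - 1) n).hom (w (n - 1)) := rfl

variable (B k hk) in
/-- The projection from the path object. -/
def pathHom : B.path k hk ⟶ B where
  map :=
    { f := fun n => ModuleCat.ofHom (B.pathEval n)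
      comm' := fun i j hij => by
        obtain rfl : i = j - 1 := by
          have : i + 1 = j := hij
          lia
        refine ModuleCat.hom_ext (LinearMap.ext fun ⟨v, w⟩ => ?_)
        refine (congrArg (B.cpx.d (j - 1) j).hom (B.pathEval_apply (j - 1) v w)).trans ?_
        refine Eq.trans ?_ (congrArg (B.pathEval j) (B.pathCpx_d (j - 1) j (by lia) v w)).symm
        rw [map_add, d_d_apply, add_zero, pathEval_apply, Pi.zero_apply, zero_add] }
  map_mem p n := by
    rintro ⟨v, w⟩ ⟨h1, h2⟩
    refine add_mem h1.1 ?_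
    exact ((mem_Z' (by lia) (by lia)).1 h2).2

/-- A `k`-cycle placed in the `v` slot is again a `k`-cycle of the path object, because its
differential drops the filtration by `k`. For `k = 0` this is surjectivity on the filtration steps.
-/
lemma mapZ_pathHom_surjective (p n : ℤ) : Function.Surjective (mapZ (B.pathHom k hk) k p n) := by
  classical
  rintro ⟨y, hy⟩
  have hs : (Pi.single n y : ∀ n, B.cpx.X n) n = y :=
    Pi.single_eq_same (M := fun n => B.cpx.X n) n y
  refine ⟨⟨((Pi.single n y, 0) : (∀ n, B.cpx.X n) × (∀ n, B.cpx.X n)), mem_path_Z.2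
    ⟨⟨?_, zero_mem _⟩, ?_⟩⟩, Subtype.ext ?_⟩
  · rwa [hs]
  · rwa [hs, sub_add_cancel]
  · refine (B.pathEval_apply n (Pi.single n y) 0).trans ?_
    rw [hs, Pi.zero_apply, map_zero, add_zero]

lemma pageMap_pathHom_surjective (i : ℤ × ℤ) :
    Function.Surjective ((pageMap (B.pathHom k hk) k).f i) := by
  intro y
  obtain ⟨y, rfl⟩ := Submodule.mkQ_surjective _ y
  obtain ⟨z, rfl⟩ := mapZ_pathHom_surjective (hk := hk) _ _ y
  exact ⟨(B.path k hk).cls _ _ _ z, rfl⟩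

end Path

end FilteredComplex

/-! ### Factorization through a biproduct in an additive category -/

section Factorization

variable {C : Type*} [Category C] [Preadditive C] [HasFiniteBiproducts C]

/-- Any morphism `u : X ⟶ Y` factors through the biproduct of `X` and any finite family of
objects over `Y`. -/
lemma exists_factorization_of_family {n : ℕ} {X Y : C} (D : Fin n → C) (π : ∀ k, D k ⟶ Y)
    (u : X ⟶ Y) :
    ∃ (T : C) (i : X ⟶ T) (p : T ⟶ Y) (q : T ⟶ X), i ≫ p = u ∧ i ≫ q = 𝟙 X ∧
      (∀ k, ∃ s : D k ⟶ T, s ≫ p = π k) ∧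
      ∀ {A : Type _} [Category A] [Preadditive A] (Φ : C ⥤ A) [Φ.Additive],
        (∀ k, IsZero (Φ.obj (D k))) → IsIso (Φ.map q) := by
  have := HasBinaryBiproducts.of_hasBinaryProducts (C := C)
  refine ⟨X ⊞ ⨁ D, biprod.inl, biprod.desc u (biproduct.desc π), biprod.fst, by simp, by simp,
    fun k => ⟨biproduct.ι D k ≫ biprod.inr, by simp⟩, ?_⟩
  intro A _ _ Φ _ h
  refine ⟨Φ.map biprod.inl, ?_, by rw [← Φ.map_comp]; simp⟩
  -- The identity of `⨁ D` is a sum of maps through the `D k`, each of which becomes zero under `Φ`.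
  have h0 : Φ.map (𝟙 (⨁ D)) = 0 := by
    rw [← biproduct.total, Functor.map_sum]
    refine Finset.sum_eq_zero fun k _ => ?_
    rw [Φ.map_comp, (h k).eq_of_src (Φ.map (biproduct.ι D k)) 0, comp_zero]
  -- The identity of `⨁ D` is inserted so that `h0` kills the second idempotent of the biproduct.
  have h1 : (biprod.snd : X ⊞ ⨁ D ⟶ _) ≫ 𝟙 _ ≫ (biprod.inr : _ ⟶ X ⊞ ⨁ D) =
      biprod.snd ≫ biprod.inr := by simp
  rw [← Φ.map_comp, ← Φ.map_id, ← biprod.total, Φ.map_add, ← h1, Φ.map_comp biprod.snd,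
    Φ.map_comp (𝟙 _), h0, zero_comp, comp_zero, add_zero]

end Factorization

lemma ModuleCat.surjective_of_isIso {R : Type u} [CommRing R] {M N : ModuleCat.{v} R} (f : M ⟶ N)
    [IsIso f] : Function.Surjective f :=
  (ModuleCat.epi_iff_surjective f).1 inferInstance

/-! ### The almost Brown structure on spectral sequences -/

namespace SpSe

variable {R : Type u} [CommRing R] {r : ℕ} {X Y T : SpSe.{v} R}

lemma weq_iff (f : X ⟶ Y) :
    SpSe.weq R r f ↔ ∀ i, IsIso ((SpectralSequence.Hom.hom f ((r : ℤ) + 1)).f i) :=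
  SpectralSequence.quasiIso_hom_iff f r _ (by lia) rfl

lemma hasTwoOutOfThree : (SpSe.weq.{v} R r).HasTwoOutOfThreeProperty :=
  inferInstanceAs (((HomologicalComplex.quasiIso (ModuleCat.{v} R) (rShape r)).inverseImage
    (SpectralSequence.pageFunctor _ rShape 0 (r : ℤ))).HasTwoOutOfThreeProperty)

lemma weq_of_isIso (f : X ⟶ Y) [IsIso f] : SpSe.weq R r f :=
  (weq_iff f).2 fun i => inferInstanceAs (IsIso ((SpectralSequence.pageFunctor _ _ _ ((r : ℤ) + 1) ⋙
    HomologicalComplex.eval _ _ i).map f))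

lemma fib_comp (f : X ⟶ Y) (g : Y ⟶ T) (hf : SpSe.fib R r f) (hg : SpSe.fib R r g) :
    SpSe.fib R r (f ≫ g) :=
  fun k hk i => (hg k hk i).comp (hf k hk i)

lemma fib_of_isIso (f : X ⟶ Y) [IsIso f] : SpSe.fib R r f := fun k _ i => by
  have : IsIso ((SpectralSequence.Hom.hom f (k : ℤ)).f i) :=
    inferInstanceAs (IsIso ((SpectralSequence.pageFunctor _ _ _ (k : ℤ) ⋙
      HomologicalComplex.eval _ _ i).map f))
  exact ModuleCat.surjective_of_isIso _

lemma surjective_of_comp (s : X ⟶ Y) (p : Y ⟶ T) (k : ℤ) (hk : 0 ≤ k) (i : ℤ × ℤ)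
    (h : Function.Surjective ((SpectralSequence.Hom.hom (s ≫ p) k hk).f i)) :
    Function.Surjective ((SpectralSequence.Hom.hom p k hk).f i) :=
  Function.Surjective.of_comp h

lemma pagesSurjective_of_acyclicFib {f : X ⟶ Y} (hf : (SpSe.weq R r ⊓ SpSe.fib R r) f) :
    SpectralSequence.PagesSurjective f :=
  SpectralSequence.pagesSurjective_of_quasiIso f r (by lia) hf.1 fun k hk hkr i => by
    lift k to ℕ using hk
    exact hf.2 k (by lia) i

/-- The hypothesis is pagewise so that the lemma serves both categories, being applied also to the
image under `E` of a square of filtered complexes. Isomorphisms on page `r + 1` and surjections on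
pages up to `r` are stable under pullback. -/
lemma acyclicFib_of_isPullback_page {P X Y S : SpSe.{v} R} {a : P ⟶ X} {b : P ⟶ Y} {f : X ⟶ S}
    {g : Y ⟶ S} (hf : (SpSe.weq R r ⊓ SpSe.fib R r) f)
    (h : ∀ (k : ℤ) (hk : 0 ≤ k), IsPullback (SpectralSequence.Hom.hom a k)
      (SpectralSequence.Hom.hom b k) (SpectralSequence.Hom.hom f k)
      (SpectralSequence.Hom.hom g k)) :
    (SpSe.weq R r ⊓ SpSe.fib R r) b := by
  constructor
  · rw [weq_iff]
    intro i
    have := (weq_iff f).1 hf.1 i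
    exact (HomologicalComplex.isPullback_eval (h _ (by lia)) i).isIso_snd_of_isIso
  · intro k hk i y
    obtain ⟨x, hx⟩ := hf.2 k hk i ((SpectralSequence.Hom.hom g (k : ℤ)).f i y)
    obtain ⟨z, -, hz⟩ := (ModuleCat.isPullback_iff_elementwise.1
      (HomologicalComplex.isPullback_eval (h k (by lia)) i)).2.2 x y hx
    exact ⟨z, hz⟩

/-- The discs with `0 ≤ k ≤ r` are added to `X`: the `k`-th one gives surjectivity on page `k`, and
all of them vanish on page `r + 1`, where the projection to `X` is therefore an isomorphism. -/
lemma factorization (r : ℕ) (u : X ⟶ Y) :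
    ∃ (T : SpSe.{v} R) (i : X ⟶ T) (p : T ⟶ Y) (q : T ⟶ X),
      i ≫ p = u ∧ SpSe.fib R r p ∧ i ≫ q = 𝟙 X ∧ (SpSe.weq R r ⊓ SpSe.fib R r) q := by
  have := HasFiniteBiproducts.of_hasFiniteProducts (C := SpSe.{v} R)
  obtain ⟨T, i, p, q, h1, h2, h3, h4⟩ := exists_factorization_of_family
    (fun k : Fin (r + 1) => Y.disc (k : ℕ) (by lia)) (fun k => Y.discHom _ _) u
  refine ⟨T, i, p, q, h1, fun k hk j => ?_, h2, (weq_iff q).2 fun j => ?_, fun k _ j => ?_⟩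
  · obtain ⟨s, hs⟩ := h3 ⟨k, by lia⟩
    refine surjective_of_comp s p k _ j ?_
    rw [hs]
    exact Y.discHom_surjective k _ j
  · exact h4 (SpectralSequence.pageFunctor _ _ _ ((r : ℤ) + 1) ⋙ HomologicalComplex.eval _ _ j)
      fun k => Y.isZero_disc_page _ _ _ (by lia) (by have := k.2; lia) j
  -- The projection `q` has the section `i`, so it is surjective on every page.
  · refine surjective_of_comp i q k _ j ?_
    rw [h2]
    exact Function.surjective_id

variable (R r) in
lemma isAlmostBrown : IsAlmostBrown (SpSe.weq.{v} R r) (SpSe.fib.{v} R r) where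
  hasFiniteProducts := inferInstance
  twoOutOfThree := hasTwoOutOfThree
  weq_of_isIso f _ := weq_of_isIso f
  fib_comp f g := fib_comp f g
  fib_of_isIso f _ := fib_of_isIso f
  hasPullback _ g hp := (SpectralSequence.isPullback_pagewisePullback (g := g)
    (pagesSurjective_of_acyclicFib hp)).hasPullback
  acyclicFib_of_isPullback h hp := acyclicFib_of_isPullback_page hp fun k hk =>
    SpectralSequence.isPullback_page (pagesSurjective_of_acyclicFib hp) h k hk
  factorization u := factorization r u
  fibrant he f k _ i := SpectralSequence.pagesSurjective_of_isZero
    (IsZero.of_iso (SpectralSequence.isZero_zero _ _ _)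
      (he.uniqueUpToIso (SpectralSequence.isZero_zero _ _ _).isTerminal)) f k (by lia) i

end SpSe

/-! ### The almost Brown structure on filtered complexes and left exactness of `E` -/

namespace FilteredComplex

variable {R : Type u} [CommRing R] {r : ℕ} {X Y T : FilteredComplex.{v} R}

/-- Apart from surjectivity on filtration steps, both classes of maps are inverse images under `E`,
so most axioms are inherited from spectral sequences. -/
lemma fib_iff (f : X ⟶ Y) :
    fib R r f ↔ FSurjective f ∧ SpSe.fib R r ((spectralSequence R).map f) := Iff.rfl

lemma weq_map_iff (f : X ⟶ Y) :
    weq R r f ↔ SpSe.weq R r ((spectralSequence R).map f) := Iff.rfl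

lemma map_acyclicFib {f : X ⟶ Y} (hf : (weq R r ⊓ fib R r) f) :
    (SpSe.weq R r ⊓ SpSe.fib R r) ((spectralSequence R).map f) := ⟨hf.1, hf.2.2⟩

lemma fSurjective_comp {f : X ⟶ Y} {g : Y ⟶ T} (hf : FSurjective f) (hg : FSurjective g) :
    FSurjective (f ≫ g) := fun p n => (hg p n).comp (hf p n)

lemma fSurjective_of_comp {f : X ⟶ Y} {g : Y ⟶ T} (h : FSurjective (f ≫ g)) : FSurjective g :=
  fun p n => Function.Surjective.of_comp (g := mapZ f 0 p n) (h p n)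

lemma fSurjective_id (X : FilteredComplex.{v} R) : FSurjective (𝟙 X) :=
  fun _ _ => Function.surjective_id

/-- Pullbacks of acyclic fibrations are computed pagewise. -/
lemma isPullback_pageMap {P A U B : FilteredComplex.{v} R} {a : P ⟶ A} {b : P ⟶ U} {f : A ⟶ B}
    {g : U ⟶ B} (hf : (weq R r ⊓ fib R r) f) (h : IsPullback a b f g) (k : ℤ) (hk : 0 ≤ k) :
    IsPullback (SpectralSequence.Hom.hom ((spectralSequence R).map a) k)
      (SpectralSequence.Hom.hom ((spectralSequence R).map b) k)
      (SpectralSequence.Hom.hom ((spectralSequence R).map f) k)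
      (SpectralSequence.Hom.hom ((spectralSequence R).map g) k) :=
  SpectralSequence.isPullback_page_of_first
    (SpSe.pagesSurjective_of_acyclicFib (map_acyclicFib hf))
    (isPullback_page_zero hf.2.1 h) k hk

lemma factorization (r : ℕ) (u : X ⟶ Y) :
    ∃ (T : FilteredComplex.{v} R) (i : X ⟶ T) (p : T ⟶ Y) (q : T ⟶ X),
      i ≫ p = u ∧ fib R r p ∧ i ≫ q = 𝟙 X ∧ (weq R r ⊓ fib R r) q := by
  have := HasFiniteBiproducts.of_hasFiniteProducts (C := FilteredComplex.{v} R)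
  obtain ⟨T, i, p, q, h1, h2, h3, h4⟩ := exists_factorization_of_family
    (fun k : Fin (r + 1) => Y.path (k : ℕ) (by lia)) (fun k => Y.pathHom _ _) u
  refine ⟨T, i, p, q, h1, ⟨?_, fun k hk j => ?_⟩, h2, ?_, ?_, fun k _ j => ?_⟩
  -- The summand with `k = 0` is present for every `r` and already covers each `F_p` of `Y`.
  · obtain ⟨s, hs⟩ := h3 0
    refine fSurjective_of_comp (f := s) ?_
    rw [hs]
    exact mapZ_pathHom_surjective (k := 0) (hk := le_rfl)
  · obtain ⟨s, hs⟩ := h3 ⟨k, by lia⟩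
    refine SpSe.surjective_of_comp ((spectralSequence R).map s) ((spectralSequence R).map p) k
      (by lia) j ?_
    rw [← Functor.map_comp, hs]
    exact pageMap_pathHom_surjective (B := Y) (k := k) (hk := by lia) j
  · rw [weq_map_iff, SpSe.weq_iff]
    exact fun j => h4 (spectralSequence R ⋙ SpectralSequence.pageFunctor _ _ _ ((r : ℤ) + 1) ⋙
      HomologicalComplex.eval _ _ j)
      fun k => isZero_path_page (by have := k.2; lia) j
  · refine fSurjective_of_comp (f := i) ?_
    rw [h2]
    exact fSurjective_id X
  · refine SpSe.surjective_of_comp ((spectralSequence R).map i) ((spectralSequence R).map q) k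
      (by lia) j ?_
    rw [← Functor.map_comp, h2, CategoryTheory.Functor.map_id]
    exact Function.surjective_id

variable (R r) in
lemma isAlmostBrown : IsAlmostBrown (weq.{v} R r) (fib.{v} R r) where
  hasFiniteProducts := inferInstance
  twoOutOfThree := by
    have := SpSe.hasTwoOutOfThree.{v} (R := R) (r := r)
    exact inferInstanceAs
      (((SpSe.weq.{v} R r).inverseImage (spectralSequence R)).HasTwoOutOfThreeProperty)
  weq_of_isIso f _ := SpSe.weq_of_isIso ((spectralSequence R).map f)
  fib_comp f g hf hg := by
    rw [fib_iff, Functor.map_comp]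
    exact ⟨fSurjective_comp hf.1 hg.1, SpSe.fib_comp ((spectralSequence R).map f)
      ((spectralSequence R).map g) hf.2 hg.2⟩
  fib_of_isIso f _ := ⟨fSurjective_of_comp (f := inv f) (by
    rw [IsIso.inv_hom_id]
    exact fSurjective_id _), SpSe.fib_of_isIso ((spectralSequence R).map f)⟩
  hasPullback p g _ := (isPullback_fiberProduct p g).hasPullback
  acyclicFib_of_isPullback h hp := by
    have := SpSe.acyclicFib_of_isPullback_page (map_acyclicFib hp) (isPullback_pageMap hp h)
    exact ⟨this.1, FSurjective.of_isPullback hp.2.1 h, this.2⟩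
  factorization u := factorization r u
  fibrant {X e} he f := by
    have hz : IsZero e := IsZero.of_iso (isZero_zero R)
      (he.uniqueUpToIso (isZero_zero R).isTerminal)
    refine ⟨fun p n y => ?_, fun k _ i => SpectralSequence.pagesSurjective_of_isZero
      ((spectralSequence R).map_isZero hz) ((spectralSequence R).map f) k (by lia) i⟩
    have := subsingleton_of_isZero hz n
    exact ⟨0, Subsingleton.elim _ _⟩

variable (R r) in
lemma isLeftExactFunctor_spectralSequence :
    IsLeftExactFunctor (weq.{v} R r) (fib.{v} R r) (SpSe.weq.{v} R r) (SpSe.fib.{v} R r)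
      (spectralSequence.{v} R) where
  finiteProducts := inferInstance
  fib _ hf := hf.2
  acyclicFib _ hf := map_acyclicFib hf
  pullback h hp := SpectralSequence.isPullback_of_page (isPullback_pageMap hp h)

end FilteredComplex

end

theorem mainTheorem6 (R : Type u) [CommRing R] (r : ℕ) :
    IsAlmostBrown (FilteredComplex.weq.{v} R r) (FilteredComplex.fib.{v} R r) ∧
    IsAlmostBrown (SpSe.weq.{v} R r) (SpSe.fib.{v} R r) ∧
    (∀ {A B : FilteredComplex.{v} R} (f : A ⟶ B), FilteredComplex.weq R r f →
      SpSe.weq R r ((FilteredComplex.spectralSequence R).map f)) ∧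
    IsLeftExactFunctor (FilteredComplex.weq.{v} R r) (FilteredComplex.fib.{v} R r)
      (SpSe.weq.{v} R r) (SpSe.fib.{v} R r) (FilteredComplex.spectralSequence.{v} R) ∧
    (∀ {X A U B : FilteredComplex.{v} R} {p' : X ⟶ U} {g' : X ⟶ A} {p : A ⟶ B} {g : U ⟶ B},
      IsPullback g' p' p g → FilteredComplex.weq R r p → FilteredComplex.fib R r p →
      ∀ k : ℕ,
        IsPullback
          (((FilteredComplex.spectralSequence R).map g').hom (k : ℤ))
          (((FilteredComplex.spectralSequence R).map p').hom (k : ℤ))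
          (((FilteredComplex.spectralSequence R).map p).hom (k : ℤ))
          (((FilteredComplex.spectralSequence R).map g).hom (k : ℤ))) :=
  ⟨FilteredComplex.isAlmostBrown R r, SpSe.isAlmostBrown R r, fun _ hf => hf,
    FilteredComplex.isLeftExactFunctor_spectralSequence R r,
    fun h hp hp' k => FilteredComplex.isPullback_pageMap ⟨hp, hp'⟩ h k (by lia)⟩
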